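/- Let $\mathbf k$ be a commutative $\mathbb Q$-algebra. **Notation.** Let $\mathfrak f_2$ be the free Lie $\mathbf k$-algebra on $x_0,x_1$, and set $e_0:=x_0$, $e_1:=-x_1$, $e_\infty:=-e_0-e_1$. In $U(\mathfrak f_2)$ put $\mathcal W_l:=\mathbf k1\oplus U(\mathfrak f_2)e_1$, $(\mathcal W_l)_+:=U(\mathfrak f_2)e_1$ and $\mathcal W_r:=\mathbf k1\oplus e_1U(\mathfrak f_2)$. Let $\Delta_\star:\mathcal W_l\to\mathcal W_l^{\otimes2}$ be the algebra morphism obtained, through the isomorphism $\mathbf k\langle y_n\mid n\ge1\rangle\simeq\mathcal W_l$, $y_n\mapsto x_0^{n-1}x_1$, from $$y_n\mapsto y_n\otimes1+1\otimes y_n+\sum_{n',n''>0,\ n'+n''=n}y_{n'}\otimes y_{n''}.$$ Let $\mathrm{Ad}(e_1):\mathcal W_l\to\mathcal W_r$ be the algebra isomorphism $1\mapsto1$, $ae_1\mapsto e_1a$, and $\Delta_\star^{l,r}:=\mathrm{Ad}(e_1)^{\otimes2}\circ\Delta_\star:\mathcal W_l\to\mathcal W_r^{\otimes2}$. Let $(U(\mathfrak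 f_2),\cdot_{e_1})$ be the module $U(\mathfrak f_2)$ with the (non-unital) product $r\cdot_{e_1}r'=re_1r'$, and let $\mathrm{mor}^l:(U(\mathfrak f_2),\cdot_{e_1})\to(\mathcal W_l)_+$ be $r\mapsto re_1$. Let $\mathfrak p_5$ be the Lie $\mathbf k$-algebra with generators $e_{ij}$ ($i\ne j\in\{1,\dots,5\}$) and relations $e_{ji}=e_{ij}$, $\sum_{j\neq i}e_{ij}=0$, and $[e_{ij},e_{kl}]=0$ for $i,j,k,l$ all distinct. Let $\ell:U(\mathfrak f_2)\to U(\mathfrak p_5)$ be the algebra morphism with $e_0\mapsto e_{23}$, $e_1\mapsto e_{12}$, and let $\mathrm{pr}_1,\mathrm{pr}_2,\mathrm{pr}_5:\mathfrak p_5\to\mathfrak f_2$ be the Lie algebra morphisms given by $$\begin{array}{c|cccccccccc} & e_{12}&e_{13}&e_{14}&e_{15}&e_{23}&e_{24}&e_{25}&e_{34}&e_{35}&e_{45}\\\hline \mathrm{pr}_1&0&0&0&0&e_0&e_\infty&e_1&e_1&e_\infty&e_0\\ \mathrm{pr}_2&0&e_\infty&e_0&e_1&0&0&0&e_1&e_0&e_\infty\\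 \mathrm{pr}_5&e_1&e_\infty&e_0&0&e_0&e_\infty&0&e_1&0&0\end{array}$$ Let $\mathrm{pr}_{12}:U(\mathfrak p_5)\to U(\mathfrak f_2)^{\otimes2}$ be the algebra morphism with $x\mapsto\mathrm{pr}_1(x)\otimes1+1\otimes\mathrm{pr}_2(x)$ for $x\in\mathfrak p_5$, let $M_3(\mathrm{pr}_{12})$ be its entrywise extension to $3\times3$ matrices, and let $J:=\mathrm{Ker}(\mathrm{pr}_5:U(\mathfrak p_5)\to U(\mathfrak f_2))$. Finally let $$\mathrm{row}:=\begin{pmatrix}e_1\otimes1&-1\otimes e_1&0\end{pmatrix},\qquad \mathrm{col}:=\begin{pmatrix}1\\-1\\0\end{pmatrix}.$$ **Statement.** The ideal $J$ is free as a left $U(\mathfrak p_5)$-module, with basis $(e_{15},e_{25},e_{35})$. Let $\varpi:U(\mathfrak p_5)\to M_3(U(\mathfrak p_5))$, $p\mapsto(a_{ij}(p))_{i,j}$, be the algebra morphism defined by $e_{i5}\,p=\sum_{j=1}^3a_{ij}(p)\,e_{j5}$ for $i=1,2,3$. Then for every $u\in U(\mathfrak f_2)$, $$\mathrm{row}\cdot\big(M_3(\mathrm{pr}_{12})\circ\varpi\circ\ell\big)(u)\cdot\mathrm{col}=\Delta_\star^{l,r}\big(\mathrm{mor}^l(u)\big)=\Delta_\star^{l,r}(ue_1)$$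 in $U(\mathfrak f_2)^{\otimes2}$, where $\mathcal W_r^{\otimes2}$ is mapped to $U(\mathfrak f_2)^{\otimes2}$ by the inclusion; that is, the following diagram commutes: $$\begin{array}{ccccccccc}U(\mathfrak f_2)&\xrightarrow{\ \ell\ }&U(\mathfrak p_5)&\xrightarrow{\ \varpi\ }&M_3(U(\mathfrak p_5))&\xrightarrow{M_3(\mathrm{pr}_{12})}&M_3(U(\mathfrak f_2)^{\otimes2})&\xrightarrow[\diamond]{\mathrm{row}\cdot(-)\cdot\mathrm{col}}&U(\mathfrak f_2)^{\otimes2}\\ {\scriptstyle\diamond}\downarrow{\scriptstyle\simeq}&&&&&&&&\uparrow\\ (U(\mathfrak f_2),\cdot_{e_1})&&\xrightarrow[\ \simeq\ ]{\mathrm{mor}^l}&&(\mathcal W_l)_+&&\xrightarrow{\ \Delta_\star^{l,r}\ }&&\mathcal W_r^{\otimes2}\end{array}$$ Here $\mathrm{mor}^l$ is an isomorphism, the map $\mathcal W_r^{\otimes2}\to U(\mathfrak f_2)^{\otimes2}$ is injective, and all maps are algebra morphisms, except for the two marked with $\diamond$ (the identity map $U(\mathfrak f_2)\to(U(\mathfrak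 f_2),\cdot_{e_1})$ and $\mathrm{row}\cdot(-)\cdot\mathrm{col}$), which are $\mathbf k$-module morphisms and, if $\mathbf k\neq0$, are not multiplicative. -/

import Mathlib

open scoped TensorProduct

namespace HarmonicDR

noncomputable section

attribute [local instance] LieRing.ofAssociativeRing

/-! ### Algebras with twisted product, and matrix representations attached to ideals -/

section General

variable (k : Type*) [CommRing k]

/-- The algebra `(R, ·ₑ)`: the module `R` with the product `r ·ₑ r' = r * e * r'`.
It is associative, but in general not unital. -/
def Twisted {R : Type*} (_e : R) : Type _ := R

section Twisted

variable {R : Type*} [Ring R] [Algebra k R] (e : R)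

instance : AddCommGroup (Twisted e) := inferInstanceAs (AddCommGroup R)

instance : Module k (Twisted e) := inferInstanceAs (Module k R)

/-- The identity map of `R`, as a `k`-module isomorphism from `R` to `(R, ·ₑ)`. -/
def toTwisted : R ≃ₗ[k] Twisted e := LinearEquiv.refl k R

instance : Mul (Twisted e) :=
  ⟨fun x y => ((show R from x) * e * (show R from y) : R)⟩

theorem toTwisted_mul_toTwisted (x y : R) :
    toTwisted k e x * toTwisted k e y = toTwisted k e (x * e * y) := rfl

instance : NonUnitalRing (Twisted e) where
  left_distrib a b c := mul_add ((show R from a) * e) (show R from b) (show R from c)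
  right_distrib a b c := by
    change ((show R from a) + (show R from b)) * e * (show R from c) =
      (show R from a) * e * (show R from c) + (show R from b) * e * (show R from c)
    rw [add_mul, add_mul]
  zero_mul a := by
    change (0 : R) * e * (show R from a) = (0 : R)
    rw [zero_mul, zero_mul]
  mul_zero a := mul_zero ((show R from a) * e)
  mul_assoc a b c := by
    have h (a b c : R) : a * e * b * e * c = a * e * (b * e * c) := by simp only [mul_assoc]
    exact h a b c

/-- The (non-unital) subalgebra `Re` of `R`. -/
def leftMul : NonUnitalSubalgebra k R where
  carrier := {x | ∃ a, x = a * e}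
  add_mem' := by
    rintro _ _ ⟨a, rfl⟩ ⟨b, rfl⟩
    exact ⟨a + b, (add_mul a b e).symm⟩
  zero_mem' := ⟨0, (zero_mul e).symm⟩
  mul_mem' := by
    rintro _ _ ⟨a, rfl⟩ ⟨b, rfl⟩
    exact ⟨a * e * b, by simp only [mul_assoc]⟩
  smul_mem' := by
    rintro c _ ⟨a, rfl⟩
    exact ⟨c • a, (smul_mul_assoc c a e).symm⟩

/-- The algebra morphism `(R, ·ₑ) → Re`, `r ↦ re`. -/
def morL : Twisted e →ₙₐ[k] leftMul k e where
  toFun r := ⟨(show R from r) * e, _, rfl⟩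
  map_smul' c r := Subtype.ext (smul_mul_assoc c (show R from r) e)
  map_zero' := Subtype.ext (zero_mul e)
  map_add' r s := Subtype.ext (add_mul (show R from r) (show R from s) e)
  map_mul' r s := Subtype.ext (mul_assoc ((show R from r) * e) (show R from s) e)

/-- The subalgebra `k1 + Re` of `R`. -/
def unitalLeft : Subalgebra k R where
  carrier := {x | ∃ (c : k) (a : R), x = algebraMap k R c + a * e}
  add_mem' := by
    rintro _ _ ⟨c, a, rfl⟩ ⟨d, b, rfl⟩
    exact ⟨c + d, a + b, by rw [map_add, add_mul]; abel⟩
  mul_mem' := by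
    rintro _ _ ⟨c, a, rfl⟩ ⟨d, b, rfl⟩
    refine ⟨c * d, (algebraMap k R c + a * e) * b + a * algebraMap k R d, ?_⟩
    have h : a * algebraMap k R d * e = a * e * algebraMap k R d := by
      rw [mul_assoc, Algebra.commutes d e, mul_assoc]
    rw [map_mul, mul_add, add_mul _ _ e, h, add_mul, mul_assoc _ b e]
    abel
  algebraMap_mem' c := ⟨c, 0, by rw [zero_mul, add_zero]⟩

/-- The subalgebra `k1 + eR` of `R`. -/
def unitalRight : Subalgebra k R where
  carrier := {x | ∃ (c : k) (a : R), x = algebraMap k R c + e * a}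
  add_mem' := by
    rintro _ _ ⟨c, a, rfl⟩ ⟨d, b, rfl⟩
    exact ⟨c + d, a + b, by rw [map_add, mul_add]; abel⟩
  mul_mem' := by
    rintro _ _ ⟨c, a, rfl⟩ ⟨d, b, rfl⟩
    refine ⟨c * d, a * (algebraMap k R d + e * b) + algebraMap k R c * b, ?_⟩
    have h : e * (algebraMap k R c * b) = algebraMap k R c * (e * b) := by
      rw [← mul_assoc, ← Algebra.commutes c e, mul_assoc]
    rw [map_mul, mul_add e, h, add_mul, mul_add (algebraMap k R c), ← mul_assoc e a]
    abel
  algebraMap_mem' c := ⟨c, 0, by rw [mul_zero, add_zero]⟩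

/-- The inclusion `Re ⊆ k1 + Re`. -/
def leftMulIncl : leftMul k e →ₙₐ[k] unitalLeft k e where
  toFun x := ⟨x, 0, x.2.choose, by rw [map_zero, zero_add]; exact x.2.choose_spec⟩
  map_smul' _ _ := rfl
  map_zero' := rfl
  map_add' _ _ := rfl
  map_mul' _ _ := rfl

end Twisted

/-- If the two-sided ideal `J` of `R` is free as a left `R`-module with basis `(j_a)`, this is the
algebra morphism `R → M_d(R)`, `r ↦ (m_{ab}(r))`, where `j_a r = ∑_b m_{ab}(r) j_b`. -/
def matrixRep {R : Type*} [Ring R] [Algebra k R] {d : ℕ} (J : Ideal R) [J.IsTwoSided]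
    (j : Module.Basis (Fin d) R J) : R →ₐ[k] Matrix (Fin d) (Fin d) R :=
  have key (r : R) (M : Matrix (Fin d) (Fin d) R)
      (h : ∀ a, (j a : R) * r = ∑ b, M a b * (j b : R)) :
      (Matrix.of fun a b => j.repr ⟨(j a : R) * r, J.mul_mem_right r (j a).2⟩ b) = M := by
    ext a b
    have h' : (⟨(j a : R) * r, J.mul_mem_right r (j a).2⟩ : J) = ∑ b, M a b • j b := by
      apply Subtype.ext
      rw [AddSubmonoidClass.coe_finsetSum]
      exact h a
    rw [Matrix.of_apply, h', j.repr_sum_self]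
  have spec (r : R) (a : Fin d) : (j a : R) * r =
      ∑ b, (Matrix.of fun a b => j.repr ⟨(j a : R) * r, J.mul_mem_right r (j a).2⟩ b) a b
        * (j b : R) := by
    have h := congrArg (Subtype.val) (j.sum_repr ⟨(j a : R) * r, J.mul_mem_right r (j a).2⟩)
    rw [AddSubmonoidClass.coe_finsetSum] at h
    exact h.symm
  AlgHom.ofLinearMap
    { toFun := fun r =>
        Matrix.of fun a b => j.repr ⟨(j a : R) * r, J.mul_mem_right r (j a).2⟩ b
      map_add' := fun r s => key _ _ fun a => by
        simp only [Matrix.add_apply, add_mul, Finset.sum_add_distrib, ← spec, mul_add]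
      map_smul' := fun c r => key _ _ fun a => by
        simp only [Matrix.smul_apply, smul_mul_assoc, ← Finset.smul_sum, ← spec,
          mul_smul_comm, RingHom.id_apply] }
    (key _ _ fun a => by
      simp [Matrix.one_apply])
    (fun r s => key _ _ fun a => by
      change _ = ∑ b, ((Matrix.of fun a b => j.repr ⟨(j a : R) * r, _⟩ b) *
        (Matrix.of fun a b => j.repr ⟨(j a : R) * s, _⟩ b)) a b * (j b : R)
      simp only [Matrix.mul_apply, Finset.sum_mul, mul_assoc]
      rw [Finset.sum_comm]
      simp only [← Finset.mul_sum]
      rw [← mul_assoc, spec r a, Finset.sum_mul]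
      refine Finset.sum_congr rfl fun b _ => ?_
      rw [mul_assoc, spec s b])

/-- The defining relation of `matrixRep`. -/
theorem mul_eq_sum_matrixRep {R : Type*} [Ring R] [Algebra k R] {d : ℕ} (J : Ideal R)
    [J.IsTwoSided] (j : Module.Basis (Fin d) R J) (r : R) (a : Fin d) :
    (j a : R) * r = ∑ b, matrixRep k J j r a b * (j b : R) := by
  have h := congrArg (Subtype.val) (j.sum_repr ⟨(j a : R) * r, J.mul_mem_right r (j a).2⟩)
  rw [AddSubmonoidClass.coe_finsetSum] at h
  exact h.symm

/-- The `k`-linear map `row · (-) · col : M_n(S) → S`. -/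
def rowMulCol {S : Type*} [Ring S] [Algebra k S] {n : ℕ} (row : Matrix (Fin 1) (Fin n) S)
    (col : Matrix (Fin n) (Fin 1) S) : Matrix (Fin n) (Fin n) S →ₗ[k] S where
  toFun m := (row * m * col) 0 0
  map_add' x y := by rw [Matrix.mul_add, Matrix.add_mul, Matrix.add_apply]
  map_smul' c x := by
    rw [Matrix.mul_smul, Matrix.smul_mul, Matrix.smul_apply, RingHom.id_apply]

/-- The morphism `U(𝔤) → U(𝔥)` induced by a Lie algebra morphism `𝔤 → 𝔥`. -/
def envMap {L M : Type*} [LieRing L] [LieAlgebra k L] [LieRing M] [LieAlgebra k M]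
    (f : L →ₗ⁅k⁆ M) : UniversalEnvelopingAlgebra k L →ₐ[k] UniversalEnvelopingAlgebra k M :=
  UniversalEnvelopingAlgebra.lift k ((UniversalEnvelopingAlgebra.ι k).comp f)

/-- The canonical morphism `U(𝔤 ⊕ 𝔥) → U(𝔤) ⊗ U(𝔥)`, which takes `(x, y) ∈ 𝔤 ⊕ 𝔥` to
`x ⊗ 1 + 1 ⊗ y`. -/
def envProd (L M : Type*) [LieRing L] [LieAlgebra k L] [LieRing M] [LieAlgebra k M] :
    UniversalEnvelopingAlgebra k (L × M) →ₐ[k]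
      UniversalEnvelopingAlgebra k L ⊗[k] UniversalEnvelopingAlgebra k M :=
  UniversalEnvelopingAlgebra.lift k
    { toFun := fun x => UniversalEnvelopingAlgebra.ι k x.1 ⊗ₜ[k] 1 +
        1 ⊗ₜ[k] UniversalEnvelopingAlgebra.ι k x.2
      map_add' := fun x y => by
        simp only [Prod.fst_add, Prod.snd_add, map_add, TensorProduct.add_tmul,
          TensorProduct.tmul_add]
        abel
      map_smul' := fun c x => by
        simp only [Prod.smul_fst, Prod.smul_snd, map_smul, TensorProduct.smul_tmul',
          TensorProduct.tmul_smul, smul_add, RingHom.id_apply]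
      map_lie' := fun {x y} => by
        simp only [LieAlgebra.Prod.bracket_apply, LieHom.map_lie,
          LieRing.of_associative_ring_bracket, mul_add, add_mul,
          Algebra.TensorProduct.tmul_mul_tmul, mul_one, one_mul, TensorProduct.sub_tmul,
          TensorProduct.tmul_sub]
        abel }

end General

/-! ### The free Lie algebra `𝔣₂` and its enveloping algebra -/

section FreeLie

variable (k : Type*) [CommRing k]

/-- The free Lie algebra `𝔣₂` over the two letters `x₀, x₁`. -/
abbrev F2 : Type _ := FreeLieAlgebra k (Fin 2)

/-- The enveloping algebra `U(𝔣₂)`. -/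
abbrev UF2 : Type _ := UniversalEnvelopingAlgebra k (F2 k)

/-- `e₀ = x₀` in `𝔣₂`. -/
def e₀ : F2 k := FreeLieAlgebra.of k 0

/-- `e₁ = -x₁` in `𝔣₂`. -/
def e₁ : F2 k := -FreeLieAlgebra.of k 1

/-- `e_∞ = -e₀ - e₁` in `𝔣₂`. -/
def eInf : F2 k := -e₀ k - e₁ k

/-- `e₀` in `U(𝔣₂)`. -/
def E₀ : UF2 k := UniversalEnvelopingAlgebra.ι k (e₀ k)

/-- `e₁` in `U(𝔣₂)`. -/
def E₁ : UF2 k := UniversalEnvelopingAlgebra.ι k (e₁ k)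

/-- The Lie algebra morphism from `𝔣₂` with given images of `e₀` and `e₁`. -/
def f2Lift {L : Type*} [LieRing L] [LieAlgebra k L] (a b : L) : F2 k →ₗ⁅k⁆ L :=
  FreeLieAlgebra.lift k ![a, -b]

@[simp] theorem f2Lift_e₀ {L : Type*} [LieRing L] [LieAlgebra k L] (a b : L) :
    f2Lift k a b (e₀ k) = a := by simp [f2Lift, e₀]

@[simp] theorem f2Lift_e₁ {L : Type*} [LieRing L] [LieAlgebra k L] (a b : L) :
    f2Lift k a b (e₁ k) = b := by simp [f2Lift, e₁]

/-- The algebra morphism from `U(𝔣₂)` with given images of `e₀` and `e₁`. -/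
def uf2Lift {A : Type*} [Ring A] [Algebra k A] (a b : A) : UF2 k →ₐ[k] A :=
  UniversalEnvelopingAlgebra.lift k (f2Lift k a b)

@[simp] theorem uf2Lift_E₀ {A : Type*} [Ring A] [Algebra k A] (a b : A) :
    uf2Lift k a b (E₀ k) = a := by
  rw [uf2Lift, E₀, UniversalEnvelopingAlgebra.lift_ι_apply, f2Lift_e₀]

@[simp] theorem uf2Lift_E₁ {A : Type*} [Ring A] [Algebra k A] (a b : A) :
    uf2Lift k a b (E₁ k) = b := by
  rw [uf2Lift, E₁, UniversalEnvelopingAlgebra.lift_ι_apply, f2Lift_e₁]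

theorem uf2_hom_ext {A : Type*} [Ring A] [Algebra k A] {f g : UF2 k →ₐ[k] A}
    (h₀ : f (E₀ k) = g (E₀ k)) (h₁ : f (E₁ k) = g (E₁ k)) : f = g := by
  apply UniversalEnvelopingAlgebra.hom_ext
  apply FreeLieAlgebra.hom_ext
  intro x
  have h₁' : f (UniversalEnvelopingAlgebra.ι k (FreeLieAlgebra.of k 1)) =
      g (UniversalEnvelopingAlgebra.ι k (FreeLieAlgebra.of k 1)) := by
    have h := congrArg Neg.neg h₁
    simpa only [E₁, e₁, map_neg, neg_neg] using h
  fin_cases x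
  · exact h₀
  · exact h₁'

/-- A `k`-submodule of `U(𝔣₂)` stable by left multiplication by `e₀` and `e₁` is stable by left
multiplication by `U(𝔣₂)`. -/
theorem uf2_mul_mem (M : Submodule k (UF2 k)) (h₀ : ∀ m ∈ M, E₀ k * m ∈ M)
    (h₁ : ∀ m ∈ M, E₁ k * m ∈ M) (u : UF2 k) {m : UF2 k} (hm : m ∈ M) : u * m ∈ M := by
  let S : Subalgebra k (UF2 k) :=
    { carrier := {u | ∀ m ∈ M, u * m ∈ M}
      add_mem' := fun {a b} ha hb m hm => by
        rw [add_mul]; exact M.add_mem (ha m hm) (hb m hm)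
      mul_mem' := fun {a b} ha hb m hm => by
        rw [mul_assoc]; exact ha _ (hb m hm)
      algebraMap_mem' := fun c m hm => by
        rw [← Algebra.smul_def]; exact M.smul_mem c hm }
  have h : S.val.comp (uf2Lift k (⟨E₀ k, h₀⟩ : S) ⟨E₁ k, h₁⟩) = AlgHom.id k (UF2 k) :=
    uf2_hom_ext k (by simp) (by simp)
  have hu := AlgHom.congr_fun h u
  have := (uf2Lift k (⟨E₀ k, h₀⟩ : S) ⟨E₁ k, h₁⟩ u).2 m hm
  rw [AlgHom.comp_apply, AlgHom.id_apply] at hu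
  rw [← hu]
  exact this

/-- The subalgebra `𝒲_l = k1 ⊕ U(𝔣₂)e₁` of `U(𝔣₂)`. -/
abbrev Wl : Subalgebra k (UF2 k) := unitalLeft k (E₁ k)

/-- The non-unital subalgebra `(𝒲_l)₊ = U(𝔣₂)e₁`. -/
abbrev WlPlus : NonUnitalSubalgebra k (UF2 k) := leftMul k (E₁ k)

/-- The subalgebra `𝒲_r = k1 ⊕ e₁U(𝔣₂)` of `U(𝔣₂)`. -/
abbrev Wr : Subalgebra k (UF2 k) := unitalRight k (E₁ k)

/-- The counit of `U(𝔣₂)`. -/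
def counit : UF2 k →ₐ[k] k := uf2Lift k 0 0

/-- An algebra morphism `u ↦ ((u, ∂u), (0, ε(u)))`, where `∂` is determined by
`∂(uv) = u ∂(v) + ∂(u) ε(v)`, `∂(e₀) = 0`, `∂(e₁) = 1`. -/
def foxHom : UF2 k →ₐ[k] Matrix (Fin 2) (Fin 2) (UF2 k) :=
  uf2Lift k !![E₀ k, 0; 0, 0] !![E₁ k, 1; 0, 0]

/-- The `k`-linear map `∂ : U(𝔣₂) → U(𝔣₂)` such that `∂(c + a e₁) = a` for `c ∈ k`,
`a ∈ U(𝔣₂)`. -/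
def fox : UF2 k →ₗ[k] UF2 k :=
  (Matrix.entryLinearMap k (UF2 k) 0 1) ∘ₗ (foxHom k).toLinearMap

theorem foxHom_zero_zero (u : UF2 k) : foxHom k u 0 0 = u ∧ foxHom k u 1 0 = 0 := by
  let S : Subalgebra k (Matrix (Fin 2) (Fin 2) (UF2 k)) :=
    { carrier := {m | m 1 0 = 0}
      add_mem' := fun {a b} ha hb => by
        simp only [Set.mem_ofPred_eq, Matrix.add_apply] at *; rw [ha, hb, add_zero]
      mul_mem' := fun {a b} ha hb => by
        simp only [Set.mem_ofPred_eq] at *; simp [Matrix.mul_apply, Fin.sum_univ_two, ha, hb]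
      algebraMap_mem' := fun c => by
        simp [Matrix.algebraMap_matrix_apply] }
  have hS : ∀ u, foxHom k u ∈ S := by
    intro u
    have h : S.val.comp (uf2Lift k (⟨!![E₀ k, 0; 0, 0], by simp [S]⟩ : S)
        ⟨!![E₁ k, 1; 0, 0], by simp [S]⟩) = foxHom k :=
      uf2_hom_ext k (by simp [foxHom]) (by simp [foxHom])
    rw [← h]
    exact (uf2Lift k (⟨!![E₀ k, 0; 0, 0], by simp [S]⟩ : S)
        ⟨!![E₁ k, 1; 0, 0], by simp [S]⟩ u).2
  refine ⟨?_, hS u⟩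
  let g : UF2 k →ₐ[k] UF2 k := AlgHom.ofLinearMap
    ((Matrix.entryLinearMap k (UF2 k) 0 0) ∘ₗ (foxHom k).toLinearMap)
    (by simp) (fun x y => by
      have hy : foxHom k y 1 0 = 0 := hS y
      simp [Matrix.mul_apply, Fin.sum_univ_two, hy])
  have hg : g = AlgHom.id k (UF2 k) :=
    uf2_hom_ext k (by simp [g, foxHom]) (by simp [g, foxHom])
  exact AlgHom.congr_fun hg u

@[simp] theorem fox_add_mul (c : k) (a : UF2 k) :
    fox k (algebraMap k (UF2 k) c + a * E₁ k) = a := by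
  have h := (foxHom_zero_zero k a).1
  have h1 : foxHom k (E₁ k) = !![E₁ k, 1; 0, 0] := by simp [foxHom]
  simp [fox, Matrix.mul_apply, Fin.sum_univ_two, h, h1, Matrix.algebraMap_matrix_apply]

@[simp] theorem counit_add_mul (c : k) (a : UF2 k) :
    counit k (algebraMap k (UF2 k) c + a * E₁ k) = c := by
  simp [counit]

/-- The algebra morphism `Ad(e₁) : 𝒲_l → 𝒲_r`, `c + a e₁ ↦ c + e₁ a`. -/
def adE₁ : Wl k →ₐ[k] Wr k :=
  AlgHom.ofLinearMap
    { toFun := fun w =>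
        ⟨algebraMap k (UF2 k) (counit k w) + E₁ k * fox k w, counit k w, fox k w, rfl⟩
      map_add' := fun x y => Subtype.ext (by
        simp only [Subalgebra.coe_add, map_add, mul_add]; abel)
      map_smul' := fun c x => Subtype.ext (by
        simp only [Subalgebra.coe_smul, map_smul, smul_eq_mul, map_mul, mul_smul_comm,
          RingHom.id_apply, smul_add, Algebra.smul_def c (algebraMap k (UF2 k) _)]) }
    (Subtype.ext (by
      have h1 := fox_add_mul k 1 0
      have h2 := counit_add_mul k 1 0
      simp only [map_one, zero_mul, add_zero] at h1 h2
      simp [h1]))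
    (by
      intro x y
      obtain ⟨c, a, hx⟩ := x.2
      obtain ⟨d, b, hy⟩ := y.2
      apply Subtype.ext
      change algebraMap k (UF2 k) (counit k (x.1 * y.1)) + E₁ k * fox k (x.1 * y.1) =
        (algebraMap k (UF2 k) (counit k x.1) + E₁ k * fox k x.1) *
          (algebraMap k (UF2 k) (counit k y.1) + E₁ k * fox k y.1)
      have h : (algebraMap k (UF2 k) c + a * E₁ k) * (algebraMap k (UF2 k) d + b * E₁ k) =
          algebraMap k (UF2 k) (c * d) + (c • b + d • a + a * E₁ k * b) * E₁ k := by
        simp only [mul_add, add_mul, Algebra.algebraMap_eq_smul_one, smul_mul_assoc,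
          mul_smul_comm, one_mul, mul_one, mul_assoc, mul_smul]
        module
      rw [hx, hy, h]
      simp only [fox_add_mul, counit_add_mul]
      simp only [mul_add, add_mul, Algebra.algebraMap_eq_smul_one,
        smul_mul_assoc, mul_smul_comm, one_mul, mul_one, mul_assoc, mul_smul]
      module)

theorem adE₁_apply (c : k) (a : UF2 k) :
    (adE₁ k ⟨algebraMap k (UF2 k) c + a * E₁ k, c, a, rfl⟩ : UF2 k) =
      algebraMap k (UF2 k) c + E₁ k * a := by
  simp [adE₁]

/-! ### The harmonic coproduct -/

/-- The free algebra `k⟨Y⟩` over `Y = {y_n | n ≥ 1}`. -/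
abbrev KY : Type _ := FreeAlgebra k ℕ+

/-- The generator `y_n`. -/
def y (n : ℕ+) : KY k := FreeAlgebra.ι k n

/-- The harmonic coproduct
`y_n ↦ y_n ⊗ 1 + 1 ⊗ y_n + ∑_{n', n'' > 0, n' + n'' = n} y_{n'} ⊗ y_{n''}` of `k⟨Y⟩`. -/
def deltaStarY : KY k →ₐ[k] KY k ⊗[k] KY k :=
  FreeAlgebra.lift k fun n =>
    y k n ⊗ₜ[k] 1 + 1 ⊗ₜ[k] y k n + ∑ i ∈ Finset.Ico 1 n, y k i ⊗ₜ[k] y k (n - i)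

/-- The morphism `k⟨Y⟩ → 𝒲_l`, `y_n ↦ x₀^{n-1} x₁ = -e₀^{n-1} e₁`. -/
def kyToWl : KY k →ₐ[k] Wl k :=
  FreeAlgebra.lift k fun n =>
    ⟨-(E₀ k ^ (n.natPred) * E₁ k), 0, -(E₀ k ^ n.natPred), by
      rw [map_zero, zero_add, neg_mul]⟩

/-- The `k`-linear endomorphism `y_n w ↦ y_{n+1} w`, `1 ↦ 0` of `k⟨Y⟩`. -/
def shiftY : KY k →ₗ[k] KY k :=
  (FreeAlgebra.basisFreeMonoid k ℕ+).constr k fun w =>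
    match w.toList with
    | [] => 0
    | n :: l => y k (n + 1) * FreeAlgebra.basisFreeMonoid k ℕ+ (FreeMonoid.ofList l)

theorem basis_apply (m : FreeMonoid ℕ+) :
    FreeAlgebra.basisFreeMonoid k ℕ+ m = FreeMonoid.lift (FreeAlgebra.ι k) m := by
  change FreeAlgebra.equivMonoidAlgebraFreeMonoid.symm (MonoidAlgebra.single m (1 : k)) = _
  change MonoidAlgebra.lift k (FreeAlgebra k ℕ+) (FreeMonoid ℕ+)
    (FreeMonoid.lift (FreeAlgebra.ι k)) (MonoidAlgebra.single m (1 : k)) = _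
  rw [MonoidAlgebra.lift_single, one_smul]

theorem shiftY_y_mul (n : ℕ+) (w : KY k) : shiftY k (y k n * w) = y k (n + 1) * w := by
  have hb : ∀ l : List ℕ+, FreeAlgebra.basisFreeMonoid k ℕ+ (FreeMonoid.ofList (n :: l)) =
      y k n * FreeAlgebra.basisFreeMonoid k ℕ+ (FreeMonoid.ofList l) := fun l => by
    rw [basis_apply, basis_apply, FreeMonoid.ofList_cons, map_mul, FreeMonoid.lift_eval_of, y]
  have h : (shiftY k) ∘ₗ (LinearMap.mulLeft k (y k n)) = LinearMap.mulLeft k (y k (n + 1)) := by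
    refine (FreeAlgebra.basisFreeMonoid k ℕ+).ext fun l => ?_
    change shiftY k (y k n * FreeAlgebra.basisFreeMonoid k ℕ+ (FreeMonoid.ofList l.toList)) = _
    rw [← hb]
    exact (FreeAlgebra.basisFreeMonoid k ℕ+).constr_basis k _ _
  exact LinearMap.congr_fun h w

theorem kyToWl_bijective : Function.Bijective (kyToWl k) := by
  have hy : ∀ n, (kyToWl k (y k n) : UF2 k) = -(E₀ k ^ (n.natPred) * E₁ k) := fun n => by
    simp [kyToWl, y]
  let r : UF2 k →ₐ[k] Module.End k (KY k) :=
    uf2Lift k (shiftY k) (-LinearMap.mulLeft k (y k 1))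
  have hpow : ∀ (m : ℕ) (w : KY k), ((shiftY k) ^ m) (y k 1 * w) = y k (Nat.succPNat m) * w := by
    intro m w
    induction m with
    | zero => rfl
    | succ m ih => rw [pow_succ', Module.End.mul_apply, ih, shiftY_y_mul]; rfl
  have hr : ∀ v w, r (kyToWl k v) w = v * w := by
    have h : (r.comp (Wl k).val).comp (kyToWl k) = Algebra.lmul k (KY k) := by
      apply FreeAlgebra.hom_ext
      funext n
      apply LinearMap.ext
      intro w
      change r (kyToWl k (y k n) : UF2 k) w = y k n * w
      rw [hy]
      simp [r, hpow]
    intro v w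
    exact LinearMap.congr_fun (AlgHom.congr_fun h v) w
  refine ⟨fun v v' h => ?_, ?_⟩
  · have h1 := hr v 1
    rw [h, hr, mul_one, mul_one] at h1
    exact h1.symm
  · let M : Submodule k (UF2 k) := Submodule.span k
      {m | ∃ (n : ℕ) (z : KY k), m = E₀ k ^ n * E₁ k * kyToWl k z}
    have hM : ∀ m ∈ M, m ∈ ((Wl k).val.comp (kyToWl k)).range.toSubmodule := by
      intro m hm
      refine (Submodule.span_le.2 ?_) hm
      rintro _ ⟨n, z, rfl⟩
      refine ⟨-(y k (Nat.succPNat n)) * z, ?_⟩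
      simp [hy]
    have h₀ : ∀ m ∈ M, E₀ k * m ∈ M := by
      intro m hm
      have : M ≤ M.comap (LinearMap.mulLeft k (E₀ k)) := by
        refine Submodule.span_le.2 ?_
        rintro _ ⟨n, z, rfl⟩
        refine Submodule.subset_span ⟨n + 1, z, ?_⟩
        simp [pow_succ', mul_assoc]
      exact this hm
    have h₁ : ∀ m ∈ M, E₁ k * m ∈ M := by
      intro m hm
      have : M ≤ M.comap (LinearMap.mulLeft k (E₁ k)) := by
        refine Submodule.span_le.2 ?_
        rintro _ ⟨n, z, rfl⟩
        refine Submodule.subset_span ⟨0, -(y k (Nat.succPNat n)) * z, ?_⟩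
        simp [hy, mul_assoc]
      exact this hm
    have hE : E₁ k ∈ M := Submodule.subset_span ⟨0, 1, by simp⟩
    rintro ⟨_, c, a, rfl⟩
    obtain ⟨v, hv⟩ := hM _ (uf2_mul_mem k M h₀ h₁ a hE)
    refine ⟨algebraMap k _ c + v, Subtype.ext ?_⟩
    have hv' : (kyToWl k v : UF2 k) = a * E₁ k := hv
    simp [hv']

/-- The algebra isomorphism `k⟨Y⟩ ≃ 𝒲_l`, `y_n ↦ x₀^{n-1} x₁`. -/
def kyEquivWl : KY k ≃ₐ[k] Wl k := AlgEquiv.ofBijective (kyToWl k) (kyToWl_bijective k)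

/-- The coproduct `Δ_⋆ : 𝒲_l → 𝒲_l ⊗ 𝒲_l`, obtained from that of `k⟨Y⟩` by transport. -/
def deltaStar : Wl k →ₐ[k] Wl k ⊗[k] Wl k :=
  (Algebra.TensorProduct.map (kyToWl k) (kyToWl k)).comp
    ((deltaStarY k).comp (kyEquivWl k).symm.toAlgHom)

/-- `Δ_⋆^{l,r} = Ad(e₁)^{⊗2} ∘ Δ_⋆ : 𝒲_l → 𝒲_r ⊗ 𝒲_r`. -/
def deltaStarLR : Wl k →ₐ[k] Wr k ⊗[k] Wr k :=
  (Algebra.TensorProduct.map (adE₁ k) (adE₁ k)).comp (deltaStar k)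

/-- The restriction of `Δ_⋆^{l,r}` to `(𝒲_l)₊`. -/
def deltaStarLRPlus : WlPlus k →ₙₐ[k] Wr k ⊗[k] Wr k :=
  (deltaStarLR k : Wl k →ₙₐ[k] Wr k ⊗[k] Wr k).comp (leftMulIncl k (E₁ k))

/-- The morphism `𝒲_r ⊗ 𝒲_r → U(𝔣₂) ⊗ U(𝔣₂)` induced by the inclusion. -/
def wrIncl : Wr k ⊗[k] Wr k →ₐ[k] UF2 k ⊗[k] UF2 k :=
  Algebra.TensorProduct.map (Wr k).val (Wr k).val

/-! ### Infinitesimal sphere braid Lie algebras -/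

/-- The generators `e_{ij}` in the free Lie algebra over the pairs `(i, j)`. -/
def freeGen (n : ℕ) (i j : Fin n) : FreeLieAlgebra k (Fin n × Fin n) := FreeLieAlgebra.of k (i, j)

/-- The relators of `𝔭_n`. Generators `e_{ii}` are included, and killed by the relators
of the first kind. -/
def sphereRelators (n : ℕ) : Set (FreeLieAlgebra k (Fin n × Fin n)) :=
  {x | ∃ i, x = freeGen k n i i} ∪
  {x | ∃ i j, x = freeGen k n j i - freeGen k n i j} ∪
  {x | ∃ i, x = ∑ j ∈ Finset.univ.erase i, freeGen k n i j} ∪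
  {x | ∃ i j l m, i ≠ j ∧ i ≠ l ∧ i ≠ m ∧ j ≠ l ∧ j ≠ m ∧ l ≠ m ∧
    x = ⁅freeGen k n i j, freeGen k n l m⁆}

/-- The Lie ideal generated by the relators. -/
def sphereIdeal (n : ℕ) : LieIdeal k (FreeLieAlgebra k (Fin n × Fin n)) :=
  LieSubmodule.lieSpan k _ (sphereRelators k n)

/-- The sphere infinitesimal braid Lie algebra `𝔭_n` (for `n ≥ 4`). The index set
`{1, …, n}` is replaced by `Fin n = {0, …, n - 1}`. -/
abbrev P (n : ℕ) : Type _ := FreeLieAlgebra k (Fin n × Fin n) ⧸ sphereIdeal k n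

/-- The generator `e_{i+1,j+1}` of `𝔭_n`. -/
def gen (n : ℕ) (i j : Fin n) : P k n := LieSubmodule.Quotient.mk (freeGen k n i j)

/-- The Lie algebra morphism from `𝔭_n` such that `e_{ij} ↦ f i j`. -/
def sphereLift {L : Type*} [LieRing L] [LieAlgebra k L] {n : ℕ} (f : Matrix (Fin n) (Fin n) L)
    (h0 : ∀ i, f i i = 0) (h1 : ∀ i j, f j i = f i j)
    (h2 : ∀ i, ∑ j ∈ Finset.univ.erase i, f i j = 0)
    (h3 : ∀ i j l m, i ≠ j → i ≠ l → i ≠ m → j ≠ l → j ≠ m → l ≠ m → ⁅f i j, f l m⁆ = 0) :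
    P k n →ₗ⁅k⁆ L :=
  let g : FreeLieAlgebra k (Fin n × Fin n) →ₗ⁅k⁆ L := FreeLieAlgebra.lift k fun p => f p.1 p.2
  have hg : ∀ i j, g (freeGen k n i j) = f i j := fun i j =>
    FreeLieAlgebra.lift_of_apply (R := k) (fun p : Fin n × Fin n => f p.1 p.2) (i, j)
  have hle : sphereIdeal k n ≤ g.ker := by
    refine LieSubmodule.lieSpan_le.2 ?_
    rintro _ (((⟨i, rfl⟩ | ⟨i, j, rfl⟩) | ⟨i, rfl⟩) | ⟨i, j, l, m, a, b, c, d, e, f, rfl⟩)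
    · exact LieHom.mem_ker.2 (by rw [hg, h0])
    · exact LieHom.mem_ker.2 (by rw [map_sub, hg, hg, h1, sub_self])
    · exact LieHom.mem_ker.2 (by simp only [map_sum, hg, h2])
    · exact LieHom.mem_ker.2 (by rw [LieHom.map_lie, hg, hg, h3 i j l m a b c d e f])
  { toLinearMap := (sphereIdeal k n).toSubmodule.liftQ g.toLinearMap hle
    map_lie' := fun {x y} => by
      induction x using Submodule.Quotient.induction_on
      induction y using Submodule.Quotient.induction_on
      exact LieHom.map_lie g _ _ }

@[simp] theorem sphereLift_gen {L : Type*} [LieRing L] [LieAlgebra k L] {n : ℕ}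
    (f : Matrix (Fin n) (Fin n) L) (h0 : ∀ i, f i i = 0) (h1 : ∀ i j, f j i = f i j)
    (h2 : ∀ i, ∑ j ∈ Finset.univ.erase i, f i j = 0)
    (h3 : ∀ i j l m, i ≠ j → i ≠ l → i ≠ m → j ≠ l → j ≠ m → l ≠ m → ⁅f i j, f l m⁆ = 0)
    (i j : Fin n) : sphereLift k f h0 h1 h2 h3 (gen k n i j) = f i j :=
  FreeLieAlgebra.lift_of_apply (R := k) (fun p : Fin n × Fin n => f p.1 p.2) (i, j)

/-- The enveloping algebra `U(𝔭₅)`. -/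
abbrev UP5 : Type _ := UniversalEnvelopingAlgebra k (P k 5)

/-- The images of the `e_{ij}` by `pr₁`. -/
def pr₁Table : Matrix (Fin 5) (Fin 5) (F2 k) :=
  !![0, 0, 0, 0, 0;
     0, 0, e₀ k, eInf k, e₁ k;
     0, e₀ k, 0, e₁ k, eInf k;
     0, eInf k, e₁ k, 0, e₀ k;
     0, e₁ k, eInf k, e₀ k, 0]

/-- The images of the `e_{ij}` by `pr₂`. -/
def pr₂Table : Matrix (Fin 5) (Fin 5) (F2 k) :=
  !![0, 0, eInf k, e₀ k, e₁ k;
     0, 0, 0, 0, 0;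
     eInf k, 0, 0, e₁ k, e₀ k;
     e₀ k, 0, e₁ k, 0, eInf k;
     e₁ k, 0, e₀ k, eInf k, 0]

/-- The images of the `e_{ij}` by `pr₅`. -/
def pr₅Table : Matrix (Fin 5) (Fin 5) (F2 k) :=
  !![0, e₁ k, eInf k, e₀ k, 0;
     e₁ k, 0, e₀ k, eInf k, 0;
     eInf k, e₀ k, 0, e₁ k, 0;
     e₀ k, eInf k, e₁ k, 0, 0;
     0, 0, 0, 0, 0]

/-- A criterion for the last hypothesis of `sphereLift`. -/
theorem table_lie_eq_zero (f : Matrix (Fin 5) (Fin 5) (F2 k)) (T : Fin 5 → Fin 5 → Fin 4)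
    (hf : ∀ i j, f i j = ![0, e₀ k, e₁ k, eInf k] (T i j))
    (hT : ∀ i j l m, [i, j, l, m].Nodup → T i j = 0 ∨ T l m = 0 ∨ T i j = T l m)
    (i j l m : Fin 5) (h1 : i ≠ j) (h2 : i ≠ l) (h3 : i ≠ m) (h4 : j ≠ l) (h5 : j ≠ m)
    (h6 : l ≠ m) : ⁅f i j, f l m⁆ = 0 := by
  rw [hf, hf]
  rcases hT i j l m (by simp [h1, h2, h3, h4, h5, h6]) with h | h | h
  · rw [h]; exact zero_lie _
  · rw [h]; exact lie_zero _
  · rw [h]; exact lie_self _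

/-- The Lie algebra morphism `pr₁ : 𝔭₅ → 𝔭₄ ≃ 𝔣₂`, where the isomorphism `𝔭₄ ≃ 𝔣₂` is
`e₁₄ = e₂₃ ↦ e₀`, `e₁₂ = e₃₄ ↦ e₁`, `e₁₃ = e₂₄ ↦ e_∞`. -/
def pr₁ : P k 5 →ₗ⁅k⁆ F2 k :=
  sphereLift k (pr₁Table k) (by intro i; fin_cases i <;> rfl)
    (by intro i j; fin_cases i <;> fin_cases j <;> rfl)
    (by
      intro i
      fin_cases i <;>
        simp [Fin.sum_univ_five, Finset.sum_erase_eq_sub, pr₁Table, eInf] <;> abel)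
    (table_lie_eq_zero k _ ![![0, 0, 0, 0, 0], ![0, 0, 1, 3, 2], ![0, 1, 0, 2, 3], ![0, 3, 2, 0, 1], ![0, 2, 3, 1, 0]]
      (by intro i j; fin_cases i <;> fin_cases j <;> rfl) (by decide))

/-- The Lie algebra morphism `pr₂ : 𝔭₅ → 𝔭₄ ≃ 𝔣₂`. -/
def pr₂ : P k 5 →ₗ⁅k⁆ F2 k :=
  sphereLift k (pr₂Table k) (by intro i; fin_cases i <;> rfl)
    (by intro i j; fin_cases i <;> fin_cases j <;> rfl)
    (by
      intro i
      fin_cases i <;>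
        simp [Fin.sum_univ_five, Finset.sum_erase_eq_sub, pr₂Table, eInf] <;> abel)
    (table_lie_eq_zero k _ ![![0, 0, 3, 1, 2], ![0, 0, 0, 0, 0], ![3, 0, 0, 2, 1], ![1, 0, 2, 0, 3], ![2, 0, 1, 3, 0]]
      (by intro i j; fin_cases i <;> fin_cases j <;> rfl) (by decide))

/-- The Lie algebra morphism `pr₅ : 𝔭₅ → 𝔭₄ ≃ 𝔣₂`. -/
def pr₅ : P k 5 →ₗ⁅k⁆ F2 k :=
  sphereLift k (pr₅Table k) (by intro i; fin_cases i <;> rfl)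
    (by intro i j; fin_cases i <;> fin_cases j <;> rfl)
    (by
      intro i
      fin_cases i <;>
        simp [Fin.sum_univ_five, Finset.sum_erase_eq_sub, pr₅Table, eInf] <;> abel)
    (table_lie_eq_zero k _ ![![0, 2, 3, 1, 0], ![2, 0, 1, 3, 0], ![3, 1, 0, 2, 0], ![1, 3, 2, 0, 0], ![0, 0, 0, 0, 0]]
      (by intro i j; fin_cases i <;> fin_cases j <;> rfl) (by decide))

/-- The morphism `U(pr₅) : U(𝔭₅) → U(𝔭₄) ≃ U(𝔣₂)`. -/
def upr₅ : UP5 k →ₐ[k] UF2 k := envMap k (pr₅ k)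

/-- The two-sided ideal `J(pr₅) = Ker(U(𝔭₅) → U(𝔭₄) ≃ U(𝔣₂))` of `U(𝔭₅)`. -/
abbrev J5 : Ideal (UP5 k) := RingHom.ker (upr₅ k)

/-- The elements `e₁₅, e₂₅, e₃₅` of `U(𝔭₅)`. -/
def e5 (i : Fin 3) : UP5 k := UniversalEnvelopingAlgebra.ι k (gen k 5 (![0, 1, 2] i) 4)

/-- The morphism `pr₁₂ : U(𝔭₅) → U(𝔣₂) ⊗ U(𝔣₂)` induced by `(pr₁, pr₂) : 𝔭₅ → 𝔣₂ ⊕ 𝔣₂`. -/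
def pr₁₂ : UP5 k →ₐ[k] UF2 k ⊗[k] UF2 k :=
  (envProd k (F2 k) (F2 k)).comp (envMap k ((pr₁ k).prod (pr₂ k)))

/-- The morphism `ℓ : U(𝔣₂) → U(𝔭₅)` induced by `𝔣₂ → 𝔭₅`, `e₀ ↦ e₂₃`, `e₁ ↦ e₁₂`. -/
def ell : UF2 k →ₐ[k] UP5 k := envMap k (f2Lift k (gen k 5 1 2) (gen k 5 0 1))

/-- The row matrix `(e₁ ⊗ 1, -1 ⊗ e₁, 0)`. -/
def row : Matrix (Fin 1) (Fin 3) (UF2 k ⊗[k] UF2 k) :=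
  !![E₁ k ⊗ₜ[k] 1, -(1 ⊗ₜ[k] E₁ k), 0]

/-- The column matrix `(1, -1, 0)ᵗ`. -/
def col : Matrix (Fin 3) (Fin 1) (UF2 k ⊗[k] UF2 k) := !![1; -1; 0]

end FreeLie

end

end HarmonicDR

namespace HarmonicDR

noncomputable section

attribute [local instance] LieRing.ofAssociativeRing

/-! ### Generators and relations of `U(𝔭₅)` -/

section SphereFive

variable (k : Type*) [CommRing k]

/-! Freeness of `J`. The algebra `U(𝔭₅)` is generated by e₁₂, e₂₃, e₁₅, e₂₅, e₃₅ (`ugen_eq`). The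
commutation relations move e₁₂ and e₂₃ from the right of the e_{a5} to their left (`e5_mul_ugen`),
so the left ideal spanned by the e_{a5} is two-sided. Modulo it every u equals ℓ(pr₅ u), as is
checked on generators; hence it is `J` (`sub_ell_upr₅_mem`). Independence comes from Fox calculus.
Coefficients D_a with u - ℓ(pr₅ u) = ∑ D_a(u) e_{a5} should satisfy D(uv) = u D(v) + D(u) ρ(v),
where ρ(v) is the matrix of right multiplication by ℓ(pr₅ v) on the e_{a5}. In block triangular form
such a D is an algebra morphism (`foxHom₅`), which exists once its values on the e_{ij} satisfy the
relations of 𝔭₅. Since ρ(e_{a5}) = 0, D reads off the coefficients of ∑ u_a e_{a5}.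

Commutativity of the diagram. The morphism `rho` sends e₁ to the rank one matrix col · row
(`rho_E₁`), so u ↦ row · rho(u) · col is multiplicative for the product u e₁ v. The lower route is
multiplicative for this product as well, being built from algebra morphisms. The powers e₀ⁿ generate
U(𝔣₂) under it, so it suffices to compare the two routes there: `upper_E₀_pow` solves a linear
recursion, and `lower_E₀_pow` unfolds the coproduct of y_{n+1}. -/

/-- The generator `e_{i+1,j+1}` of `U(𝔭₅)`. -/
def ugen (i j : Fin 5) : UP5 k := UniversalEnvelopingAlgebra.ι k (gen k 5 i j)

theorem mk_eq_zero_of_mem_sphereRelators {n : ℕ} {x : FreeLieAlgebra k (Fin n × Fin n)}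
    (hx : x ∈ sphereRelators k n) :
    (LieSubmodule.Quotient.mk x : P k n) = 0 :=
  (LieSubmodule.Quotient.mk_eq_zero _).2 (LieSubmodule.subset_lieSpan hx)

theorem ugen_self (i : Fin 5) : ugen k i i = 0 := by
  rw [ugen, gen, mk_eq_zero_of_mem_sphereRelators k (.inl (.inl (.inl ⟨i, rfl⟩))), map_zero]

theorem ugen_comm (i j : Fin 5) : ugen k j i = ugen k i j := by
  have h := mk_eq_zero_of_mem_sphereRelators k
    (.inl (.inl (.inr ⟨i, j, rfl⟩)) : _ ∈ sphereRelators k 5)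
  have h' : gen k 5 j i - gen k 5 i j = 0 := h
  rw [ugen, sub_eq_zero.1 h', ugen]

theorem sum_ugen (i : Fin 5) : ∑ j, ugen k i j = 0 := by
  have h := mk_eq_zero_of_mem_sphereRelators k
    (.inl (.inr ⟨i, rfl⟩) : _ ∈ sphereRelators k 5)
  have h' : ∑ j ∈ Finset.univ.erase i, gen k 5 i j = 0 := by
    rw [← h]
    exact (map_sum (LieSubmodule.Quotient.mk' (sphereIdeal k 5)) _ _).symm
  rw [← Finset.add_sum_erase _ _ (Finset.mem_univ i), ugen_self, zero_add]
  simp only [ugen]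
  rw [← map_sum, h', map_zero]

theorem ugen_mul_comm {i j l m : Fin 5} (h : [i, j, l, m].Nodup) :
    ugen k i j * ugen k l m = ugen k l m * ugen k i j := by
  simp only [List.nodup_cons, List.mem_cons, List.not_mem_nil, not_or] at h
  have h1 : ⁅gen k 5 i j, gen k 5 l m⁆ = 0 :=
    mk_eq_zero_of_mem_sphereRelators k
      (.inr ⟨i, j, l, m, h.1.1, h.1.2.1, h.1.2.2.1, h.2.1.1, h.2.1.2.1, h.2.2.1.1, rfl⟩ :
        _ ∈ sphereRelators k 5)
  have h2 := congrArg (UniversalEnvelopingAlgebra.ι k) h1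
  rw [LieHom.map_lie, map_zero, LieRing.of_associative_ring_bracket, sub_eq_zero] at h2
  exact h2

/-- The elements of the free Lie algebra whose image lies in `S` form a Lie subalgebra containing
the letters, hence everything. So 𝔭₅ maps into `S`, and the universal property of `U(𝔭₅)` gives a
section of the inclusion of `S`. -/
theorem subalgebra_eq_top_of_ugen_mem (S : Subalgebra k (UP5 k)) (hS : ∀ i j, ugen k i j ∈ S) :
    S = ⊤ := by
  let L' : LieSubalgebra k (FreeLieAlgebra k (Fin 5 × Fin 5)) :=
    { S.toSubmodule.comap ((UniversalEnvelopingAlgebra.ι k : P k 5 →ₗ⁅k⁆ UP5 k).toLinearMap ∘ₗ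
        (sphereIdeal k 5).toSubmodule.mkQ) with
      lie_mem' := fun {x y} hx hy => by
        change UniversalEnvelopingAlgebra.ι k ⁅(LieSubmodule.Quotient.mk x : P k 5),
          (LieSubmodule.Quotient.mk y : P k 5)⁆ ∈ S
        rw [LieHom.map_lie, LieRing.of_associative_ring_bracket]
        exact S.sub_mem (S.mul_mem hx hy) (S.mul_mem hy hx) }
  have hL' : ∀ x, x ∈ L' := by
    intro x
    have h : L'.incl.comp (FreeLieAlgebra.lift k fun p => (⟨FreeLieAlgebra.of k p, hS p.1 p.2⟩ : L'))
        = LieHom.id := FreeLieAlgebra.hom_ext fun p => by simp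
    have hx := LieHom.congr_fun h x
    rw [LieHom.comp_apply, LieHom.id_apply] at hx
    rw [← hx]
    exact Subtype.prop _
  have hι : ∀ x : P k 5, UniversalEnvelopingAlgebra.ι k x ∈ S := fun x => by
    induction x using Submodule.Quotient.induction_on with
    | H x => exact hL' x
  let ι' : P k 5 →ₗ⁅k⁆ S :=
    { toFun x := ⟨UniversalEnvelopingAlgebra.ι k x, hι x⟩
      map_add' x y := Subtype.ext (map_add _ x y)
      map_smul' c x := Subtype.ext (map_smul _ c x)
      map_lie' {x y} := Subtype.ext (LieHom.map_lie _ x y) }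
  have h : S.val.comp (UniversalEnvelopingAlgebra.lift k ι') = AlgHom.id k (UP5 k) :=
    UniversalEnvelopingAlgebra.hom_ext k (LieHom.ext fun x => by simp [ι'])
  refine eq_top_iff.2 fun u _ => ?_
  have hu := AlgHom.congr_fun h u
  rw [AlgHom.comp_apply, AlgHom.id_apply] at hu
  rw [← hu]
  exact Subtype.prop _

theorem linear_relations {M : Type*} [AddCommGroup M] [Module ℚ M]
    {a b c d e f g h i j : M} (h0 : a + b + c + d = 0) (h1 : a + e + f + g = 0)
    (h2 : b + e + h + i = 0) (h3 : c + f + h + j = 0) (h4 : d + g + i + j = 0) :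
    j = -d - g - i ∧ b = -d - g - i - a - e ∧ c = g + i + e ∧ f = -a - e - g ∧
      h = a + d + g := by
  have hb : b = -d - g - i - a - e := by
    -- With a, …, j the ten edges of the complete graph on five vertices, adding the vertex sums
    -- other than that of vertex 4 and subtracting the latter counts twice each edge avoiding 4 and
    -- cancels the others. Hence the division by 2.
    linear_combination (norm := module) (1 / 2 : ℚ) • (h0 + h1 + h2 - h3 + h4)
  refine ⟨?_, hb, ?_, ?_, ?_⟩
  · linear_combination (norm := module) h4
  · linear_combination (norm := module) h0 - hb
  · linear_combination (norm := module) h1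
  · linear_combination (norm := module) h2 - hb

/-- The generators `e_{ij}` of `U(𝔭₅)` in terms of `e₁₂, e₂₃, e₁₅, e₂₅, e₃₅`. -/
theorem ugen_eq [Algebra ℚ k] :
    ugen k 3 4 = -ugen k 0 4 - ugen k 1 4 - ugen k 2 4 ∧
    ugen k 0 2 = -ugen k 0 4 - ugen k 1 4 - ugen k 2 4 - ugen k 0 1 - ugen k 1 2 ∧
    ugen k 0 3 = ugen k 1 4 + ugen k 2 4 + ugen k 1 2 ∧
    ugen k 1 3 = -ugen k 0 1 - ugen k 1 2 - ugen k 1 4 ∧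
    ugen k 2 3 = ugen k 0 1 + ugen k 0 4 + ugen k 1 4 := by
  have h0 := sum_ugen k 0
  have h1 := sum_ugen k 1
  have h2 := sum_ugen k 2
  have h4 := sum_ugen k 4
  have h3 := sum_ugen k 3
  simp only [Fin.sum_univ_five, ugen_self, zero_add, add_zero, ugen_comm k 0 1, ugen_comm k 0 2,
    ugen_comm k 0 3, ugen_comm k 0 4, ugen_comm k 1 2, ugen_comm k 1 3, ugen_comm k 1 4,
    ugen_comm k 2 3, ugen_comm k 2 4, ugen_comm k 3 4] at h0 h1 h2 h3 h4
  let _ : Module ℚ (UP5 k) := Module.compHom _ (algebraMap ℚ k)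
  exact linear_relations h0 h1 h2 h3 h4

end SphereFive

/-! ### Linear independence of e₁₅, e₂₅, e₃₅ by Fox calculus -/

section FreeIdeal

variable (k : Type*) [CommRing k]

theorem e5_eq : e5 k = ![ugen k 0 4, ugen k 1 4, ugen k 2 4] := by
  funext i
  fin_cases i <;> rfl

/-- The matrix of right multiplication by `e₁₂` on `(e₁₅, e₂₅, e₃₅)`. -/
def mat₁₂ : Matrix (Fin 3) (Fin 3) (UP5 k) :=
  !![ugen k 0 1 + ugen k 1 4, -ugen k 0 4, 0;
     -ugen k 1 4, ugen k 0 1 + ugen k 0 4, 0;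
     0, 0, ugen k 0 1]

/-- The matrix of right multiplication by `e₂₃` on `(e₁₅, e₂₅, e₃₅)`. -/
def mat₂₃ : Matrix (Fin 3) (Fin 3) (UP5 k) :=
  !![ugen k 1 2, 0, 0;
     0, ugen k 1 2 + ugen k 2 4, -ugen k 1 4;
     0, -ugen k 2 4, ugen k 1 2 + ugen k 1 4]

/-- The right multiplications by the generators of `𝔣₂`, in the order `0, e₀, e₁, e_∞`. -/
def rightMat : Fin 4 → Matrix (Fin 3) (Fin 3) (UP5 k) :=
  ![0, mat₂₃ k, mat₁₂ k, -mat₂₃ k - mat₁₂ k]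

/-- The table of `pr₅`, with the letters `0, e₀, e₁, e_∞` numbered from `0` to `3`. -/
def letter₅ : Fin 5 → Fin 5 → Fin 4 :=
  ![![0, 2, 3, 1, 0], ![2, 0, 1, 3, 0], ![3, 1, 0, 2, 0], ![1, 3, 2, 0, 0], ![0, 0, 0, 0, 0]]

/-- The coordinates of the Fox derivatives of the `e_{ij}`. -/
def foxRow : Fin 5 → Fin 5 → Fin 3 → UP5 k :=
  ![![0, 0, ![-1, -1, -1], ![0, 1, 1], ![1, 0, 0]],
    ![0, 0, 0, ![0, -1, 0], ![0, 1, 0]],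
    ![![-1, -1, -1], 0, 0, ![1, 1, 0], ![0, 0, 1]],
    ![![0, 1, 1], ![0, -1, 0], ![1, 1, 0], 0, ![-1, -1, -1]],
    ![![1, 0, 0], ![0, 1, 0], ![0, 0, 1], ![-1, -1, -1], 0]]

/-- The images of the `e_{ij}` by the matrix form of the Fox derivatives of `U(𝔭₅)` with respect
to `e₁₅, e₂₅, e₃₅`. -/
def foxTable : Matrix (Fin 5) (Fin 5) (Matrix (Unit ⊕ Fin 3) (Unit ⊕ Fin 3) (UP5 k)) :=
  Matrix.of fun i j => Matrix.fromBlocks (Matrix.of fun _ _ => ugen k i j)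
    (Matrix.of fun _ => foxRow k i j) 0 (rightMat k (letter₅ i j))

/-- This is the upper right block of the commutation relation. The rows `foxRow` are read off from
`ugen_eq`, with D(e₁₂) = D(e₂₃) = 0 and D(e_{a5}) the unit vectors. Their entries are integers, so
both sides are linear in the e_{ij} and agree after substituting `ugen_eq`. The ordering of the
indices leaves one case per pair of disjoint edges. -/
theorem foxTable_lie_aux [Algebra ℚ k] (i j l m : Fin 5) (hij : i < j) (hlm : l < m) (hil : i < l)
    (h : [i, j, l, m].Nodup) (b : Fin 3) :
    ugen k i j * foxRow k l m b + ∑ a, foxRow k i j a * rightMat k (letter₅ l m) a b =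
    ugen k l m * foxRow k i j b + ∑ a, foxRow k l m a * rightMat k (letter₅ i j) a b := by
  obtain ⟨h1, h2, h3, h4, h5⟩ := ugen_eq k
  fin_cases i <;> fin_cases j <;> first
  | exact absurd hij (by decide)
  | (fin_cases l <;> first
      | exact absurd hil (by decide)
      | (fin_cases m <;> first
          | exact absurd hlm (by decide)
          | exact absurd h (by decide)
          | (fin_cases b <;>
              simp [foxRow, letter₅, rightMat, mat₁₂, mat₂₃, Fin.sum_univ_three, h1, h2, h3, h4, h5] <;> abel)))

theorem letter₅_comm (i j : Fin 5) : letter₅ j i = letter₅ i j := by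
  revert i j; decide

theorem letter₅_disjoint (i j l m : Fin 5) (h : [i, j, l, m].Nodup) :
    letter₅ i j = 0 ∨ letter₅ l m = 0 ∨ letter₅ i j = letter₅ l m := by
  revert i j l m; decide

theorem foxRow_comm (i j : Fin 5) : foxRow k j i = foxRow k i j := by
  fin_cases i <;> fin_cases j <;> rfl

theorem foxTable_comm (i j : Fin 5) : foxTable k j i = foxTable k i j := by
  simp only [foxTable, Matrix.of_apply, letter₅_comm i j, foxRow_comm k i j, ugen_comm k i j]

theorem foxTable_self (i : Fin 5) : foxTable k i i = 0 := by
  have h1 : letter₅ i i = 0 := by revert i; decide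
  have h2 : foxRow k i i = 0 := by fin_cases i <;> rfl
  simp only [foxTable, Matrix.of_apply, h1, h2, ugen_self]
  exact Matrix.fromBlocks_zero

theorem sum_foxTable (i : Fin 5) : ∑ j ∈ Finset.univ.erase i, foxTable k i j = 0 := by
  have h1 : ∑ j, rightMat k (letter₅ i j) = 0 := by
    fin_cases i <;> simp [letter₅, rightMat, Fin.sum_univ_five] <;> abel
  have h2 : ∑ j, foxRow k i j = 0 := by
    fin_cases i <;> funext b <;> fin_cases b <;> simp [foxRow, Fin.sum_univ_five]
  rw [Finset.sum_erase _ (foxTable_self k i)]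
  ext (a | a) (b | b)
  · simpa [foxTable, Matrix.sum_apply] using sum_ugen k i
  · simpa [foxTable, Matrix.sum_apply] using congrFun h2 b
  · simp [foxTable, Matrix.sum_apply]
  · simpa [foxTable, Matrix.sum_apply] using congrFun (congrFun h1 a) b

theorem foxTable_mul_comm_of_lt [Algebra ℚ k] (i j l m : Fin 5) (hij : i < j) (hlm : l < m)
    (hil : i < l) (h : [i, j, l, m].Nodup) :
    foxTable k i j * foxTable k l m = foxTable k l m * foxTable k i j := by
  -- Two disjoint edges have the same image under pr₅, unless one image vanishes.
  have hR : rightMat k (letter₅ i j) * rightMat k (letter₅ l m) =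
      rightMat k (letter₅ l m) * rightMat k (letter₅ i j) := by
    rcases letter₅_disjoint i j l m h with h | h | h
    · rw [h, show rightMat k 0 = 0 from rfl, zero_mul, mul_zero]
    · rw [h, show rightMat k 0 = 0 from rfl, zero_mul, mul_zero]
    · rw [h]
  simp only [foxTable, Matrix.of_apply, Matrix.fromBlocks_multiply, hR, Matrix.mul_zero,
    Matrix.zero_mul, add_zero, zero_add]
  congr 1
  · ext a b
    simpa [Matrix.mul_apply] using ugen_mul_comm k h
  · ext a b
    simpa [Matrix.mul_apply] using foxTable_lie_aux k i j l m hij hlm hil h b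

theorem foxTable_mul_comm [Algebra ℚ k] (i j l m : Fin 5) (h : [i, j, l, m].Nodup) :
    foxTable k i j * foxTable k l m = foxTable k l m * foxTable k i j := by
  wlog hij : i < j generalizing i j
  · rw [← foxTable_comm k i j]
    refine this j i ?_ ?_ <;> grind
  wlog hlm : l < m generalizing l m
  · rw [← foxTable_comm k l m]
    refine this m l ?_ ?_ <;> grind
  wlog hil : i < l generalizing i j l m
  · refine (this l m hlm i j ?_ hij ?_).symm <;> grind
  exact foxTable_mul_comm_of_lt k i j l m hij hlm hil h

/-- The matrix form `u ↦ ((u, D u), (0, ρ u))` of the Fox derivatives of `U(𝔭₅)` with respect to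
`e₁₅, e₂₅, e₃₅`. -/
def foxHom₅ [Algebra ℚ k] : UP5 k →ₐ[k] Matrix (Unit ⊕ Fin 3) (Unit ⊕ Fin 3) (UP5 k) :=
  UniversalEnvelopingAlgebra.lift k (sphereLift k (foxTable k) (foxTable_self k) (foxTable_comm k)
    (sum_foxTable k) (fun i j l m h1 h2 h3 h4 h5 h6 => by
      rw [LieRing.of_associative_ring_bracket, sub_eq_zero]
      exact foxTable_mul_comm k i j l m (by simp [h1, h2, h3, h4, h5, h6])))

theorem foxHom₅_ugen [Algebra ℚ k] (i j : Fin 5) : foxHom₅ k (ugen k i j) = foxTable k i j := by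
  rw [foxHom₅, ugen, UniversalEnvelopingAlgebra.lift_ι_apply, sphereLift_gen]

theorem foxHom₅_blocks [Algebra ℚ k] (u : UP5 k) :
    foxHom₅ k u (.inl ()) (.inl ()) = u ∧ ∀ a, foxHom₅ k u (.inr a) (.inl ()) = 0 := by
  let S : Subalgebra k (UP5 k) :=
    { carrier := {u | foxHom₅ k u (.inl ()) (.inl ()) = u ∧
        ∀ a, foxHom₅ k u (.inr a) (.inl ()) = 0}
      add_mem' := fun {u v} hu hv => by
        simp only [Set.mem_ofPred_eq] at *
        simp [hu.1, hu.2, hv.1, hv.2]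
      mul_mem' := fun {u v} hu hv => by
        simp only [Set.mem_ofPred_eq] at *
        simp [hu.1, hu.2, hv.1, hv.2, Matrix.mul_apply]
      algebraMap_mem' := fun c => by
        simp [Matrix.algebraMap_matrix_apply] }
  have hS : S = ⊤ := subalgebra_eq_top_of_ugen_mem k S fun i j => by
    simp [S, foxHom₅_ugen, foxTable]
  exact (hS ▸ Algebra.mem_top : u ∈ S)

theorem foxHom₅_e5 [Algebra ℚ k] (a : Fin 3) :
    foxHom₅ k (e5 k a) = Matrix.fromBlocks (Matrix.of fun _ _ => e5 k a)
      (Matrix.of fun _ => Pi.single a 1) 0 0 := by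
  rw [e5_eq]
  fin_cases a
  · refine (foxHom₅_ugen k 0 4).trans ?_
    rw [foxTable, Matrix.of_apply]
    congr 1
    ext i b; fin_cases b <;> rfl
  · refine (foxHom₅_ugen k 1 4).trans ?_
    rw [foxTable, Matrix.of_apply]
    congr 1
    ext i b; fin_cases b <;> rfl
  · refine (foxHom₅_ugen k 2 4).trans ?_
    rw [foxTable, Matrix.of_apply]
    congr 1
    ext i b; fin_cases b <;> rfl

/-- In D(u_a e_{a5}) = u_a D(e_{a5}) + D(u_a) ρ(e_{a5}) the last term vanishes, and D(e_{a5}) is the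
a-th unit vector. -/
theorem foxHom₅_sum_mul_e5 [Algebra ℚ k] (u : Fin 3 → UP5 k) (b : Fin 3) :
    foxHom₅ k (∑ a, u a * e5 k a) (.inl ()) (.inr b) = u b := by
  have h (a : Fin 3) : foxHom₅ k (u a * e5 k a) (.inl ()) (.inr b) =
      if a = b then u a else 0 := by
    rw [map_mul, foxHom₅_e5, Matrix.mul_apply]
    simp [(foxHom₅_blocks k (u a)).1, Pi.single_apply, eq_comm]
  rw [map_sum, Matrix.sum_apply]
  simp [h]

theorem linearIndependent_e5 [Algebra ℚ k] : LinearIndependent (UP5 k) (e5 k) := by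
  rw [Fintype.linearIndependent_iff]
  intro u hu b
  have h := foxHom₅_sum_mul_e5 k u b
  simp only [smul_eq_mul] at hu
  rw [hu, map_zero] at h
  exact h.symm

/-! ### `J` as the left ideal generated by e₁₅, e₂₅, e₃₅ -/

theorem e5_mul_ugen [Algebra ℚ k] (a : Fin 3) :
    e5 k a * ugen k 0 1 = ∑ b, mat₁₂ k a b * e5 k b ∧
    e5 k a * ugen k 1 2 = ∑ b, mat₂₃ k a b * e5 k b := by
  obtain ⟨h1, h2, h3, h4, h5⟩ := ugen_eq k
  -- Where e_{a5} does not commute with e₁₂ or e₂₃, the relation used is its commutation with e₃₄ =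
  -- e₁₂ + e₁₅ + e₂₅ or e₁₄ = e₂₃ + e₂₅ + e₃₅.
  have c1 := ugen_mul_comm k (show [(2 : Fin 5), 3, 0, 4].Nodup by decide)
  have c2 := ugen_mul_comm k (show [(2 : Fin 5), 3, 1, 4].Nodup by decide)
  have c3 := ugen_mul_comm k (show [(0 : Fin 5), 1, 2, 4].Nodup by decide)
  have c4 := ugen_mul_comm k (show [(0 : Fin 5), 3, 1, 4].Nodup by decide)
  have c5 := ugen_mul_comm k (show [(0 : Fin 5), 3, 2, 4].Nodup by decide)
  have c6 := ugen_mul_comm k (show [(1 : Fin 5), 2, 0, 4].Nodup by decide)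
  rw [h5] at c1 c2
  rw [h3] at c4 c5
  rw [e5_eq]
  simp only [add_mul, mul_add] at c1 c2 c4 c5
  fin_cases a
  · refine ⟨?_, ?_⟩ <;> simp [mat₁₂, mat₂₃, Fin.sum_univ_three, add_mul]
    · linear_combination (norm := abel) -c1
    · exact c6.symm
  · refine ⟨?_, ?_⟩ <;> simp [mat₁₂, mat₂₃, Fin.sum_univ_three, add_mul]
    · linear_combination (norm := abel) -c2
    · linear_combination (norm := abel) -c4
  · refine ⟨?_, ?_⟩ <;> simp [mat₁₂, mat₂₃, Fin.sum_univ_three, add_mul]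
    · exact c3.symm
    · linear_combination (norm := abel) -c5

theorem upr₅_ugen (i j : Fin 5) :
    upr₅ k (ugen k i j) = UniversalEnvelopingAlgebra.ι k (pr₅Table k i j) := by
  rw [upr₅, envMap, ugen, UniversalEnvelopingAlgebra.lift_ι_apply, LieHom.comp_apply, pr₅,
    sphereLift_gen]

theorem e5_mem_J5 (a : Fin 3) : e5 k a ∈ J5 k := by
  rw [RingHom.mem_ker, e5_eq]
  fin_cases a
  · exact (upr₅_ugen k 0 4).trans (map_zero _)
  · exact (upr₅_ugen k 1 4).trans (map_zero _)
  · exact (upr₅_ugen k 2 4).trans (map_zero _)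

theorem ell_E₀ : ell k (E₀ k) = ugen k 1 2 := by
  rw [ell, envMap, E₀, UniversalEnvelopingAlgebra.lift_ι_apply, LieHom.comp_apply, f2Lift_e₀, ugen]

theorem ell_E₁ : ell k (E₁ k) = ugen k 0 1 := by
  rw [ell, envMap, E₁, UniversalEnvelopingAlgebra.lift_ι_apply, LieHom.comp_apply, f2Lift_e₁, ugen]

theorem subalgebra_eq_top_of_five_ugen_mem [Algebra ℚ k] (S : Subalgebra k (UP5 k))
    (h₁₂ : ugen k 0 1 ∈ S) (h₂₃ : ugen k 1 2 ∈ S) (h₅ : ∀ a, e5 k a ∈ S) : S = ⊤ := by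
  obtain ⟨h1, h2, h3, h4, h5⟩ := ugen_eq k
  rw [e5_eq] at h₅
  have a1 : ugen k 0 4 ∈ S := h₅ 0
  have a2 : ugen k 1 4 ∈ S := h₅ 1
  have a3 : ugen k 2 4 ∈ S := h₅ 2
  have key (i j : Fin 5) (hij : i < j) : ugen k i j ∈ S := by
    fin_cases i <;> fin_cases j <;> first
    | exact absurd hij (by decide)
    | simp only [Fin.reduceFinMk, Fin.zero_eta, Fin.mk_one, h1, h2, h3, h4, h5]
      repeat first | assumption | apply S.add_mem | apply S.sub_mem | apply S.neg_mem
  refine subalgebra_eq_top_of_ugen_mem k S fun i j => ?_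
  rcases lt_trichotomy i j with h | rfl | h
  · exact key i j h
  · rw [ugen_self]; exact S.zero_mem
  · rw [ugen_comm]; exact key j i h

theorem span_e5_mul_mem [Algebra ℚ k] (u : UP5 k) {x : UP5 k}
    (hx : x ∈ Ideal.span (Set.range (e5 k))) : x * u ∈ Ideal.span (Set.range (e5 k)) := by
  let S : Subalgebra k (UP5 k) :=
    { carrier := {u | ∀ x ∈ Ideal.span (Set.range (e5 k)), x * u ∈ Ideal.span (Set.range (e5 k))}
      add_mem' := fun {u v} hu hv x hx => by
        rw [mul_add]; exact Ideal.add_mem _ (hu x hx) (hv x hx)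
      mul_mem' := fun {u v} hu hv x hx => by
        rw [← mul_assoc]; exact hv _ (hu x hx)
      algebraMap_mem' := fun c x hx => by
        rw [← Algebra.commutes]; exact Ideal.mul_mem_left _ _ hx }
  have hgen (a) : e5 k a ∈ Ideal.span (Set.range (e5 k)) := Ideal.subset_span ⟨a, rfl⟩
  have hS (u : UP5 k) (hu : ∀ a, e5 k a * u ∈ Ideal.span (Set.range (e5 k))) : u ∈ S := by
    intro x hx
    obtain ⟨c, rfl⟩ := (Ideal.mem_span_range_iff_exists_fun).1 hx
    rw [Finset.sum_mul]
    refine Ideal.sum_mem _ fun a _ => ?_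
    rw [mul_assoc]
    exact Ideal.mul_mem_left _ _ (hu a)
  have hT : S = ⊤ := subalgebra_eq_top_of_five_ugen_mem k S
    (hS _ fun a => by
      rw [(e5_mul_ugen k a).1]
      exact Ideal.sum_mem _ fun b _ => Ideal.mul_mem_left _ _ (hgen b))
    (hS _ fun a => by
      rw [(e5_mul_ugen k a).2]
      exact Ideal.sum_mem _ fun b _ => Ideal.mul_mem_left _ _ (hgen b))
    (fun b => hS _ fun a => Ideal.mul_mem_left _ _ (hgen b))
  exact (hT ▸ Algebra.mem_top : u ∈ S) x hx

theorem sub_ell_upr₅_mem [Algebra ℚ k] (u : UP5 k) :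
    u - ell k (upr₅ k u) ∈ Ideal.span (Set.range (e5 k)) := by
  let S : Subalgebra k (UP5 k) :=
    { carrier := {u | u - ell k (upr₅ k u) ∈ Ideal.span (Set.range (e5 k))}
      add_mem' := fun {u v} hu hv => by
        simp only [Set.mem_ofPred_eq, map_add] at *
        rw [add_sub_add_comm]
        exact Ideal.add_mem _ hu hv
      mul_mem' := fun {u v} hu hv => by
        -- With s = ℓ ∘ pr₅, one has uv - s(uv) = (u - s(u)) v + s(u) (v - s(v)); the first term
        -- requires the left ideal to be stable on the right.
        have h := Ideal.add_mem _ (span_e5_mul_mem k v hu)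
          (Ideal.mul_mem_left _ (ell k (upr₅ k u)) hv)
        simp only [Set.mem_ofPred_eq, map_mul]
        rwa [sub_mul, mul_sub, sub_add_sub_cancel] at h
      algebraMap_mem' := fun c => by simp }
  have hT : S = ⊤ := subalgebra_eq_top_of_five_ugen_mem k S
    (by
      change ugen k 0 1 - ell k (upr₅ k (ugen k 0 1)) ∈ Ideal.span (Set.range (e5 k))
      rw [upr₅_ugen]
      change ugen k 0 1 - ell k (E₁ k) ∈ Ideal.span (Set.range (e5 k))
      rw [ell_E₁, sub_self]
      exact Ideal.zero_mem _)
    (by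
      change ugen k 1 2 - ell k (upr₅ k (ugen k 1 2)) ∈ Ideal.span (Set.range (e5 k))
      rw [upr₅_ugen]
      change ugen k 1 2 - ell k (E₀ k) ∈ Ideal.span (Set.range (e5 k))
      rw [ell_E₀, sub_self]
      exact Ideal.zero_mem _)
    (fun a => by
      change e5 k a - ell k (upr₅ k (e5 k a)) ∈ Ideal.span (Set.range (e5 k))
      rw [RingHom.mem_ker.1 (e5_mem_J5 k a), map_zero, sub_zero]
      exact Ideal.subset_span ⟨a, rfl⟩)
  exact (hT ▸ Algebra.mem_top : u ∈ S)

/-- The basis `(e₁₅, e₂₅, e₃₅)` of the left `U(𝔭₅)`-module `J(pr₅)`. -/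
def basisJ5 [Algebra ℚ k] : Module.Basis (Fin 3) (UP5 k) (J5 k) :=
  Module.Basis.mk (v := fun a => (⟨e5 k a, e5_mem_J5 k a⟩ : J5 k))
    (LinearIndependent.of_comp (J5 k).subtype (linearIndependent_e5 k))
    (by
      rintro ⟨x, hx⟩ -
      have h := sub_ell_upr₅_mem k x
      rw [RingHom.mem_ker.1 hx, map_zero, sub_zero] at h
      obtain ⟨c, rfl⟩ := (Ideal.mem_span_range_iff_exists_fun).1 h
      have : (⟨∑ a, c a * e5 k a, hx⟩ : J5 k) = ∑ a, c a • ⟨e5 k a, e5_mem_J5 k a⟩ :=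
        Subtype.ext (by rw [AddSubmonoidClass.coe_finsetSum]; rfl)
      rw [this]
      exact Submodule.sum_mem _ fun a _ => Submodule.smul_mem _ _ (Submodule.subset_span ⟨a, rfl⟩))

theorem basisJ5_apply [Algebra ℚ k] (a : Fin 3) : (basisJ5 k a : UP5 k) = e5 k a := by
  rw [basisJ5, Module.Basis.mk_apply]

/-- Allows ϖ(e₁₂) and ϖ(e₂₃) to be read off from `e5_mul_ugen`: D recovers the coefficients. -/
theorem matrixRep_basisJ5_eq [Algebra ℚ k] (u : UP5 k) (M : Matrix (Fin 3) (Fin 3) (UP5 k))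
    (h : ∀ a, e5 k a * u = ∑ b, M a b * e5 k b) : matrixRep k (J5 k) (basisJ5 k) u = M := by
  ext a b
  have h1 := mul_eq_sum_matrixRep k (J5 k) (basisJ5 k) u a
  simp only [basisJ5_apply] at h1
  rw [h a] at h1
  have h2 := congrArg (fun v => foxHom₅ k v (.inl ()) (.inr b)) h1
  simp only [foxHom₅_sum_mul_e5] at h2
  exact h2.symm

end FreeIdeal

/-! ### The morphism `rho` and the upper route -/

section Diagram

variable (k : Type*) [CommRing k]

theorem pr₁₂_ugen (i j : Fin 5) :
    pr₁₂ k (ugen k i j) = UniversalEnvelopingAlgebra.ι k (pr₁Table k i j) ⊗ₜ[k] 1 +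
      1 ⊗ₜ[k] UniversalEnvelopingAlgebra.ι k (pr₂Table k i j) := by
  rw [pr₁₂, AlgHom.comp_apply, envMap, ugen, UniversalEnvelopingAlgebra.lift_ι_apply,
    LieHom.comp_apply, envProd, UniversalEnvelopingAlgebra.lift_ι_apply]
  change UniversalEnvelopingAlgebra.ι k (pr₁ k (gen k 5 i j)) ⊗ₜ[k] 1 +
    1 ⊗ₜ[k] UniversalEnvelopingAlgebra.ι k (pr₂ k (gen k 5 i j)) = _
  rw [pr₁, pr₂, sphereLift_gen, sphereLift_gen]

/-- The composition `M₃(pr₁₂) ∘ ϖ ∘ ℓ`. -/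
def rho [Algebra ℚ k] : UF2 k →ₐ[k] Matrix (Fin 3) (Fin 3) (UF2 k ⊗[k] UF2 k) :=
  (pr₁₂ k).mapMatrix.comp ((matrixRep k (J5 k) (basisJ5 k)).comp (ell k))

theorem ι_eInf : UniversalEnvelopingAlgebra.ι k (eInf k) = -E₀ k - E₁ k := by
  rw [eInf, map_sub, map_neg, E₀, E₁]

theorem pr₁₂_values :
    pr₁₂ k (ugen k 0 1) = 0 ∧ pr₁₂ k (ugen k 1 2) = E₀ k ⊗ₜ[k] 1 ∧
    pr₁₂ k (ugen k 0 4) = 1 ⊗ₜ[k] E₁ k ∧ pr₁₂ k (ugen k 1 4) = E₁ k ⊗ₜ[k] 1 ∧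
    pr₁₂ k (ugen k 2 4) = 1 ⊗ₜ[k] E₀ k - E₀ k ⊗ₜ[k] 1 - E₁ k ⊗ₜ[k] 1 := by
  simp only [pr₁₂_ugen]
  refine ⟨?_, ?_, ?_, ?_, ?_⟩
  · simp [pr₁Table, pr₂Table]
  · simp [pr₁Table, pr₂Table, E₀]
  · simp [pr₁Table, pr₂Table, E₁]
  · simp [pr₁Table, pr₂Table, E₁]
  · simp only [pr₁Table, pr₂Table, Matrix.of_apply, Matrix.cons_val, ι_eInf,
      TensorProduct.sub_tmul, TensorProduct.neg_tmul]
    rw [← E₀]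
    abel

/-- Both pr₁ and pr₂ kill e₁₂, and what is left of `mat₁₂` is an outer product. This factorization
dictates `row` and `col`. -/
theorem rho_E₁ [Algebra ℚ k] : rho k (E₁ k) = col k * row k := by
  obtain ⟨h1, h2, h3, h4, h5⟩ := pr₁₂_values k
  rw [rho, AlgHom.comp_apply, AlgHom.comp_apply, ell_E₁,
    matrixRep_basisJ5_eq k _ _ fun a => (e5_mul_ugen k a).1]
  ext a b
  fin_cases a <;> fin_cases b <;> simp [mat₁₂, col, row, h1, h3, h4]

theorem rho_E₀ [Algebra ℚ k] : rho k (E₀ k) =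
    !![E₀ k ⊗ₜ[k] 1, 0, 0;
       0, 1 ⊗ₜ[k] E₀ k - E₁ k ⊗ₜ[k] 1, -(E₁ k ⊗ₜ[k] 1);
       0, E₀ k ⊗ₜ[k] 1 + E₁ k ⊗ₜ[k] 1 - 1 ⊗ₜ[k] E₀ k, E₀ k ⊗ₜ[k] 1 + E₁ k ⊗ₜ[k] 1] := by
  obtain ⟨h1, h2, h3, h4, h5⟩ := pr₁₂_values k
  rw [rho, AlgHom.comp_apply, AlgHom.comp_apply, ell_E₀,
    matrixRep_basisJ5_eq k _ _ fun a => (e5_mul_ugen k a).2]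
  ext a b
  fin_cases a <;> fin_cases b <;> simp [mat₂₃, h2, h4, h5] <;> abel

/-- The upper route of the diagram. -/
def upper [Algebra ℚ k] : UF2 k →ₗ[k] UF2 k ⊗[k] UF2 k :=
  rowMulCol k (row k) (col k) ∘ₗ (rho k).toLinearMap

theorem upper_mul [Algebra ℚ k] (u v : UF2 k) :
    upper k (u * E₁ k * v) = upper k u * upper k v := by
  change (row k * rho k (u * E₁ k * v) * col k) 0 0 =
    (row k * rho k u * col k) 0 0 * (row k * rho k v * col k) 0 0
  have h : row k * rho k (u * E₁ k * v) * col k =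
      (row k * rho k u * col k) * (row k * rho k v * col k) := by
    rw [map_mul, map_mul, rho_E₁]
    simp only [Matrix.mul_assoc]
  rw [h, Matrix.mul_apply, Fin.sum_univ_one]

/-! ### Comparison of the two routes on powers of e₀ -/

/-- The sums `∑ e₁ e₀ⁱ ⊗ e₀ʲ` over `i + j + 1 = n`. -/
def mixedSum (n : ℕ) : UF2 k ⊗[k] UF2 k :=
  ∑ p ∈ Finset.range n, (E₁ k * E₀ k ^ p) ⊗ₜ[k] (E₀ k ^ (n - 1 - p))

theorem mixedSum_succ (n : ℕ) : mixedSum k (n + 1) =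
    (1 ⊗ₜ[k] E₀ k) * mixedSum k n + (E₁ k * E₀ k ^ n) ⊗ₜ[k] 1 := by
  rw [mixedSum, Finset.sum_range_succ, mixedSum, Finset.mul_sum]
  congr 1
  · refine Finset.sum_congr rfl fun p hp => ?_
    rw [Algebra.TensorProduct.tmul_mul_tmul, one_mul, ← pow_succ']
    congr 2
    have := Finset.mem_range.1 hp
    omega
  · simp

/-- The row (1, 1, 1) is a left eigenvector of rho(e₀) with eigenvalue e₀ ⊗ 1 and kills `col`, so
the entries sum to zero. Eliminating the third one, the second satisfies c_{n+1} = (1 ⊗ e₀) c_n +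
e₁e₀ⁿ ⊗ 1 with c₀ = -1, which is the recursion of `mixedSum_succ`. -/
theorem rho_E₀_pow_mul_col [Algebra ℚ k] (n : ℕ) : rho k (E₀ k ^ n) * col k =
    !![(E₀ k ^ n) ⊗ₜ[k] 1; mixedSum k n - 1 ⊗ₜ[k] (E₀ k ^ n);
      1 ⊗ₜ[k] (E₀ k ^ n) - mixedSum k n - (E₀ k ^ n) ⊗ₜ[k] 1] := by
  induction n with
  | zero =>
    ext a b
    fin_cases a <;> fin_cases b <;>
      simp [col, mixedSum, Algebra.TensorProduct.one_def]
  | succ n ih =>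
    rw [pow_succ', map_mul, Matrix.mul_assoc, ih, rho_E₀, mixedSum_succ]
    ext a b
    fin_cases a <;> fin_cases b <;>
      simp [Matrix.mul_apply, Fin.sum_univ_three, mul_sub, sub_mul, add_mul] <;>
      abel

theorem upper_E₀_pow [Algebra ℚ k] (n : ℕ) : upper k (E₀ k ^ n) =
    (E₁ k * E₀ k ^ n) ⊗ₜ[k] 1 + 1 ⊗ₜ[k] (E₁ k * E₀ k ^ n) - 1 ⊗ₜ[k] E₁ k * mixedSum k n := by
  change (row k * rho k (E₀ k ^ n) * col k) 0 0 = _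
  rw [Matrix.mul_assoc, rho_E₀_pow_mul_col]
  simp [row, Matrix.mul_apply, Fin.sum_univ_three, mul_sub]
  abel

/-- The lower route of the diagram. -/
def lower : UF2 k →ₗ[k] UF2 k ⊗[k] UF2 k :=
  (wrIncl k).toLinearMap ∘ₗ
    ((deltaStarLRPlus k).comp (morL k (E₁ k)) : _ →ₗ[k] _) ∘ₗ (toTwisted k (E₁ k)).toLinearMap

theorem lower_mul (u v : UF2 k) : lower k (u * E₁ k * v) = lower k u * lower k v := by
  change wrIncl k (deltaStarLRPlus k (morL k (E₁ k) (toTwisted k (E₁ k) (u * E₁ k * v)))) = _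
  rw [← toTwisted_mul_toTwisted, map_mul, map_mul, map_mul]
  rfl

theorem kyToWl_y (n : ℕ+) : (kyToWl k (y k n) : UF2 k) = -(E₀ k ^ n.natPred * E₁ k) := by
  simp [kyToWl, y]

theorem adE₁_kyToWl_y (n : ℕ+) :
    (adE₁ k (kyToWl k (y k n)) : UF2 k) = -(E₁ k * E₀ k ^ n.natPred) := by
  have h : kyToWl k (y k n) =
      ⟨algebraMap k (UF2 k) 0 + -(E₀ k ^ n.natPred) * E₁ k, 0, _, rfl⟩ := by
    apply Subtype.ext
    change _ = algebraMap k (UF2 k) 0 + -(E₀ k ^ n.natPred) * E₁ k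
    rw [kyToWl_y, map_zero, zero_add, neg_mul]
  rw [h, adE₁_apply, map_zero, zero_add, mul_neg]

theorem lower_eq (u : UF2 k) (w : Wl k) (hw : (w : UF2 k) = u * E₁ k) :
    lower k u = wrIncl k (deltaStarLR k w) := by
  change wrIncl k (deltaStarLR k (leftMulIncl k (E₁ k) (morL k (E₁ k) u))) = _
  congr 2
  exact Subtype.ext hw.symm

theorem lower_E₀_pow (n : ℕ) : lower k (E₀ k ^ n) =
    (E₁ k * E₀ k ^ n) ⊗ₜ[k] 1 + 1 ⊗ₜ[k] (E₁ k * E₀ k ^ n) - 1 ⊗ₜ[k] E₁ k * mixedSum k n := by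
  -- Since e₁ = -x₁, e₀ⁿe₁ is minus the image of y_{n+1}. The linear terms of the coproduct then
  -- come out with sign +, and the quadratic ones with sign -.
  rw [lower_eq k _ (-(kyToWl k (y k n.succPNat))) (by
    rw [NegMemClass.coe_neg, kyToWl_y, neg_neg, Nat.natPred_succPNat])]
  have h1 : (kyEquivWl k).symm (kyToWl k (y k n.succPNat)) = y k n.succPNat :=
    (kyEquivWl k).symm_apply_apply _
  have h2 : deltaStarLR k (kyToWl k (y k n.succPNat)) =
      Algebra.TensorProduct.map (adE₁ k) (adE₁ k) (Algebra.TensorProduct.map (kyToWl k) (kyToWl k)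
        (deltaStarY k (y k n.succPNat))) := by
    conv_rhs => rw [← h1]
    rfl
  have h3 : ∑ i ∈ Finset.Ico 1 n.succPNat,
      (E₁ k * E₀ k ^ i.natPred) ⊗ₜ[k] (E₁ k * E₀ k ^ (n.succPNat - i).natPred) =
      1 ⊗ₜ[k] E₁ k * mixedSum k n := by
    rw [mixedSum, Finset.mul_sum]
    refine Finset.sum_nbij' (fun i => i.natPred) (fun p => p.succPNat) ?_ ?_ ?_ ?_ ?_
    · intro i hi
      have h := PNat.coe_lt_coe _ _ |>.2 (Finset.mem_Ico.1 hi).2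
      rw [Nat.succPNat_coe, ← PNat.natPred_add_one i] at h
      exact Finset.mem_range.2 (by omega)
    · intro p hp
      have h := Finset.mem_range.1 hp
      exact Finset.mem_Ico.2 ⟨one_le, Nat.succPNat_lt_succPNat.2 h⟩
    · intro i _
      exact PNat.succPNat_natPred i
    · intro p _
      exact Nat.natPred_succPNat p
    · intro i hi
      have h := (Finset.mem_Ico.1 hi).2
      have h' := PNat.coe_lt_coe _ _ |>.2 h
      -- Subtraction in `ℕ+` takes the default value 1 unless i < n + 1, which holds here. With p =
      -- i - 1, the exponent n + 1 - i - 1 is n - 1 - p.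
      have e : (n.succPNat - i).natPred = n - 1 - i.natPred := by
        rw [PNat.natPred, PNat.natPred, PNat.sub_coe, if_pos h]
        have := i.pos
        rw [Nat.succPNat_coe] at *
        omega
      rw [e, Algebra.TensorProduct.tmul_mul_tmul, one_mul]
  have h4 : deltaStarY k (y k n.succPNat) = y k n.succPNat ⊗ₜ[k] 1 + 1 ⊗ₜ[k] y k n.succPNat +
      ∑ i ∈ Finset.Ico 1 n.succPNat, y k i ⊗ₜ[k] y k (n.succPNat - i) :=
    FreeAlgebra.lift_ι_apply _ _
  rw [map_neg, h2, h4]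
  simp only [map_neg, map_add, map_sum, Algebra.TensorProduct.map_tmul, wrIncl, map_one,
    Subalgebra.coe_val, adE₁_kyToWl_y, TensorProduct.neg_tmul,
    TensorProduct.tmul_neg, neg_neg, h3, Nat.natPred_succPNat]
  abel

theorem upper_eq_lower [Algebra ℚ k] (u : UF2 k) : upper k u = lower k u := by
  -- Quantifying over all left factors e₀ⁿ makes stability under e₀ automatic; for e₁,
  -- multiplicativity splits e₀ⁿ e₁ m into the values at e₀ⁿ and at m.
  let M : Submodule k (UF2 k) :=
    ⨅ n : ℕ, (LinearMap.eqLocus (upper k) (lower k)).comap (LinearMap.mulLeft k (E₀ k ^ n))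
  have hM (u : UF2 k) : u ∈ M ↔ ∀ n, upper k (E₀ k ^ n * u) = lower k (E₀ k ^ n * u) := by
    simp [M, Submodule.mem_iInf]
  have h1 : (1 : UF2 k) ∈ M := (hM 1).2 fun n => by
    rw [mul_one, upper_E₀_pow, lower_E₀_pow]
  have h := uf2_mul_mem k M
    (fun m hm => (hM _).2 fun n => by
      rw [← mul_assoc, ← pow_succ]
      exact (hM _).1 hm _)
    (fun m hm => (hM _).2 fun n => by
      have h0 := (hM _).1 hm 0
      rw [pow_zero, one_mul] at h0
      rw [← mul_assoc, upper_mul, lower_mul, upper_E₀_pow, lower_E₀_pow, h0]) u h1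
  simpa using (hM _).1 h 0

/-! ### Injectivity and failure of multiplicativity -/

theorem morL_bijective : Function.Bijective (morL k (E₁ k)) := by
  refine ⟨fun a b h => ?_, fun ⟨x, a, ha⟩ => ⟨a, Subtype.ext ha.symm⟩⟩
  have h' : (show UF2 k from a) * E₁ k = (show UF2 k from b) * E₁ k := congrArg Subtype.val h
  have ha := fox_add_mul k 0 (show UF2 k from a)
  have hb := fox_add_mul k 0 (show UF2 k from b)
  rw [h', hb] at ha
  exact ha.symm

/-- The algebra morphism `u ↦ ((ε(u), ∂u), (0, u))`, where `∂` is determined by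
`∂(uv) = ε(u) ∂(v) + ∂(u) v`, `∂(e₀) = 0`, `∂(e₁) = 1`. -/
def coFoxHom : UF2 k →ₐ[k] Matrix (Fin 2) (Fin 2) (UF2 k) :=
  uf2Lift k !![0, 0; 0, E₀ k] !![0, 1; 0, E₁ k]

theorem coFoxHom_apply (u : UF2 k) : coFoxHom k u 1 1 = u ∧ coFoxHom k u 1 0 = 0 := by
  let M : Submodule k (UF2 k) :=
    { carrier := {u | coFoxHom k u 1 1 = u ∧ coFoxHom k u 1 0 = 0}
      add_mem' := fun {u v} hu hv => by
        simp only [Set.mem_ofPred_eq] at *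
        simp [hu.1, hu.2, hv.1, hv.2]
      zero_mem' := by simp
      smul_mem' := fun c u hu => by
        simp only [Set.mem_ofPred_eq] at *
        simp [hu.1, hu.2] }
  have h0 : coFoxHom k (E₀ k) = !![0, 0; 0, E₀ k] := by simp [coFoxHom]
  have h1 : coFoxHom k (E₁ k) = !![0, 1; 0, E₁ k] := by simp [coFoxHom]
  have h : u * 1 ∈ M := uf2_mul_mem k M
    (fun m hm => ⟨by rw [map_mul, Matrix.mul_apply, Fin.sum_univ_two, h0, hm.1]; simp,
      by rw [map_mul, Matrix.mul_apply, Fin.sum_univ_two, h0, hm.2]; simp⟩)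
    (fun m hm => ⟨by rw [map_mul, Matrix.mul_apply, Fin.sum_univ_two, h1, hm.1]; simp,
      by rw [map_mul, Matrix.mul_apply, Fin.sum_univ_two, h1, hm.2]; simp⟩) u
    ⟨by simp, by simp⟩
  rwa [mul_one] at h

/-- A `k`-linear retraction of the inclusion `𝒲_r ⊆ U(𝔣₂)`. -/
def wrRetraction : UF2 k →ₗ[k] Wr k where
  toFun u := ⟨algebraMap k (UF2 k) (counit k u) + E₁ k * coFoxHom k u 0 1, _, _, rfl⟩
  map_add' u v := Subtype.ext (by
    simp only [map_add, Matrix.add_apply, mul_add, Subalgebra.coe_add]; abel)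
  map_smul' c u := Subtype.ext (by
    simp only [map_smul, Matrix.smul_apply, smul_eq_mul, map_mul, mul_smul_comm, RingHom.id_apply,
      Subalgebra.coe_smul, smul_add, Algebra.smul_def c (algebraMap k (UF2 k) _)])

theorem wrRetraction_coe (w : Wr k) : wrRetraction k w = w := by
  obtain ⟨_, c, a, rfl⟩ := w
  apply Subtype.ext
  have h1 : coFoxHom k (E₁ k) = !![0, 1; 0, E₁ k] := by simp [coFoxHom]
  have h2 := (coFoxHom_apply k a).1
  have h3 : coFoxHom k (E₁ k * a) 0 1 = a := by
    rw [map_mul, Matrix.mul_apply, Fin.sum_univ_two, h1, h2]; simp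
  have h4 : counit k (E₁ k * a) = 0 := by simp [counit]
  simp [-map_mul, h3, h4, wrRetraction, Matrix.algebraMap_matrix_apply]

/-- Over a general ring, tensoring need not preserve injectivity, but it preserves the splitting
given by `wrRetraction`. -/
theorem wrIncl_injective : Function.Injective (wrIncl k) := by
  have h : (TensorProduct.map (wrRetraction k) (wrRetraction k)) ∘ₗ (wrIncl k).toLinearMap =
      LinearMap.id := by
    ext a b
    simp [wrIncl, wrRetraction_coe]
  exact Function.LeftInverse.injective (LinearMap.congr_fun h)

theorem not_toTwisted_mul [Nontrivial k] : ¬ ∀ x y, toTwisted k (E₁ k) (x * y) =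
    toTwisted k (E₁ k) x * toTwisted k (E₁ k) y := by
  intro h
  have h1 := (toTwisted k (E₁ k)).injective
    ((h 1 1).trans (toTwisted_mul_toTwisted k (E₁ k) 1 1))
  have h2 := congrArg (counit k) h1
  simp [counit] at h2

theorem not_rowMulCol_mul [Nontrivial k] : ¬ ∀ x y, rowMulCol k (row k) (col k) (x * y) =
    rowMulCol k (row k) (col k) x * rowMulCol k (row k) (col k) y := by
  intro h
  -- For the matrix units E₁₂ and E₂₁, the value at the product is e₁ ⊗ 1 and the product of the
  -- values is e₁ ⊗ e₁; `φ` sends these to 1 and 0.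
  let φ : UF2 k ⊗[k] UF2 k →ₐ[k] k := Algebra.TensorProduct.lift (uf2Lift k 0 1) (counit k)
    fun _ _ => Commute.all _ _
  have h1 := congrArg φ (h !![0, 1, 0; 0, 0, 0; 0, 0, 0] !![0, 0, 0; 1, 0, 0; 0, 0, 0])
  simp [rowMulCol, row, col, φ, counit, Matrix.mul_apply, Fin.sum_univ_three] at h1

end Diagram

end

end HarmonicDR

theorem mainTheorem9 (k : Type*) [CommRing k] [Algebra ℚ k] :
    -- `J(pr₅)` has the left basis `(e₁₅, e₂₅, e₃₅)`, which defines `ϖ`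
    ∃ j : Module.Basis (Fin 3) (HarmonicDR.UP5 k) (HarmonicDR.J5 k),
      (∀ i, (j i : HarmonicDR.UP5 k) = HarmonicDR.e5 k i) ∧
      -- the diagram commutes
      (∀ u : HarmonicDR.UF2 k,
        HarmonicDR.rowMulCol k (HarmonicDR.row k) (HarmonicDR.col k)
          ((HarmonicDR.pr₁₂ k).mapMatrix
            (HarmonicDR.matrixRep k (HarmonicDR.J5 k) j (HarmonicDR.ell k u))) =
        HarmonicDR.wrIncl k
          (HarmonicDR.deltaStarLRPlus k
            (HarmonicDR.morL k (HarmonicDR.E₁ k)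
              (HarmonicDR.toTwisted k (HarmonicDR.E₁ k) u)))) ∧
      -- the algebra morphism `mor^l` is an isomorphism and the right vertical map is an inclusion
      Function.Bijective (HarmonicDR.morL k (HarmonicDR.E₁ k)) ∧
      Function.Injective (HarmonicDR.wrIncl k) ∧
      -- the maps marked with a diamond are only `k`-module morphisms
      (Nontrivial k →
        (¬ ∀ x y, HarmonicDR.toTwisted k (HarmonicDR.E₁ k) (x * y) =
          HarmonicDR.toTwisted k (HarmonicDR.E₁ k) x *
            HarmonicDR.toTwisted k (HarmonicDR.E₁ k) y) ∧
        (¬ ∀ x y, HarmonicDR.rowMulCol k (HarmonicDR.row k) (HarmonicDR.col k) (x * y) =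
          HarmonicDR.rowMulCol k (HarmonicDR.row k) (HarmonicDR.col k) x *
            HarmonicDR.rowMulCol k (HarmonicDR.row k) (HarmonicDR.col k) y)) := by
  refine ⟨HarmonicDR.basisJ5 k, HarmonicDR.basisJ5_apply k, HarmonicDR.upper_eq_lower k,
    HarmonicDR.morL_bijective k, HarmonicDR.wrIncl_injective k, fun _ => ⟨?_, ?_⟩⟩
  · exact HarmonicDR.not_toTwisted_mul k
  · exact HarmonicDR.not_rowMulCol_mul k
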